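/- Process trees over a set $\mathcal A$ of activities are built from leaves $v\in\mathcal A$ and the silent leaf $\tau\notin\mathcal A$ by nodes $\oplus(M_1,\dots,M_n)$ with $\oplus\in\{\times,\rightarrow,\wedge,\circlearrowleft\}$ (choice, sequence, parallel/interleaving, loop with body $M_1$ and redo parts $M_2,\dots,M_n$), with the usual language $\mathcal L(M)\subseteq\mathcal A^*$; $A_M$ is the set of activities in $M$. An event log $L$ is a finite multiset of traces in $\mathcal A^*$. The directly-follows graph (DFG) of a set of traces records its activities, the start and the end activities of its traces, and the pairs $(a,b)$ such that $a$ is directly followed by $b$ in a trace; $L\sim_{df}M$ (df-completeness) means that the DFGs of $L$ and of $\mathcal L(M)$ are equal. Two process trees are isomorphic, $M_1\cong M_2$, if they are syntactically equal up to reordering of the children of $\times$- and $\wedge$-nodes and of the non-first children of $\circlearrowleft$-nodes. A process tree $M$ is in class $C_a$ if every node $\oplus(M_1,\dots,M_n)$ in $M$ satisfies: (1) $A_{M_i}\cap A_{M_j}=\emptyset$ for $i\ne j$; (2) if $\oplus=\circlearrowleft$, then the node is a self-loop $\circlearrowleft(v,\tau)$ with $v\in\mathcal A$; (3) if $\oplus\neq\circlearrowleft$,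 then no $M_i$ is $\tau$. It is in normal form if every node has at least two children and no $\times$-, $\rightarrow$- or $\wedge$-node has a child with the same operator. The Inductive Miner $\mathrm{pd}_{IM}$ applies to a log the first applicable one of the following steps and recurs on the resulting sublogs. Base cases: no event ($\tau$); all traces equal to $\langle a\rangle$ (leaf $a$). If there are empty traces: $\times(\tau,\cdot)$ on the nonempty traces. Cuts: a partition of the activities into a maximal number ($\ge 2$) of parts that is a choice, else a sequence, else a parallel, else a loop cut of the DFG, with the log split accordingly. Remaining fall-throughs, in this order: Activity Once Per Trace, Activity Concurrent, Strict Tau Loop (splits traces between an end activity and a directly following start activity and returns $\circlearrowleft(\cdot,\tau)$), Tau Loop, Flower Model. Lemma 3. Let $M$ be a process tree in normal form and let $L$ be an event log all of whose traces are in $\mathcal L(M)$. If $M$ is in class $C_a$ and $L\sim_{df}M$, then $\mathrm{pd}_{IM}$ discovers from $L$ a process tree $M'$ with $M'\cong M$. More precisely, some run of $\mathrm{pd}_{IM}$ on $L$ terminates with a process tree, and every process tree $M'$ with which a run on $L$ terminates, whatever choices between equally eligible cuts, activities or orders of children it makes, satisfies $M'\cong M$. -/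

import Mathlib

namespace ProcessDiscovery

/-! ## Process trees -/

/-- The four process tree operators: exclusive choice, sequence, parallel, loop. -/
inductive Op where
  | xor
  | seq
  | par
  | loop

/-- Process trees over the activities `α`; the silent activity `tau` is not an element of `α`. -/
inductive ProcessTree (α : Type*) where
  | tau : ProcessTree α
  | act : α → ProcessTree α
  | node : Op → List (ProcessTree α) → ProcessTree α

/-- `Interleaving x y z`: the trace `z` is an interleaving of the traces `x` and `y`. -/
inductive Interleaving {α : Type*} : List α → List α → List α → Prop where
  | nil : Interleaving [] [] []
  | left {x y z : List α} (a : α) : Interleaving x y z → Interleaving (a :: x) y (a :: z)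
  | right {x y z : List α} (a : α) : Interleaving x y z → Interleaving x (a :: y) (a :: z)

/-- All interleavings of a trace of `l` and a trace of `m`. -/
def shuffle {α : Type*} (l m : Language α) : Language α :=
  {z : List α | ∃ x ∈ l, ∃ y ∈ m, Interleaving x y z}

open Computability in
/-- The language of a node, from its operator and the languages of its children. A loop executes
its first child (the body), followed by any number of repetitions of
"one of the other children, then the body again". -/
def Op.combine {α : Type*} : Op → List (Language α) → Language α
  | .xor, ls => ls.sum
  | .seq, ls => ls.prod
  | .par, ls => ls.foldr shuffle 1
  | .loop, [] => 0
  | .loop, body :: redos => body * (redos.sum * body)∗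

mutual

/-- The language `ℒ(M)` of a process tree. -/
def ProcessTree.language {α : Type*} : ProcessTree α → Language α
  | .tau => 1
  | .act a => {[a]}
  | .node op ts => op.combine (ProcessTree.languages ts)

/-- The languages of a list of process trees. -/
def ProcessTree.languages {α : Type*} : List (ProcessTree α) → List (Language α)
  | [] => []
  | t :: ts => t.language :: ProcessTree.languages ts

end

/-- `Subtree N M`: the tree `N` occurs at some position in the tree `M`. -/
inductive Subtree {α : Type*} (N : ProcessTree α) : ProcessTree α → Prop where
  | refl : Subtree N N
  | child {op : Op} {ts : List (ProcessTree α)} {t : ProcessTree α} :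
      t ∈ ts → Subtree N t → Subtree N (.node op ts)

/-- The set `A_M` of the activities of a process tree. -/
def ProcessTree.activities {α : Type*} (M : ProcessTree α) : Set α :=
  {a | Subtree (.act a) M}

/-- The class `C_a`: no duplicate activities, loops only as self-loops `↺(v, τ)`, and no other
node with a child `τ`. -/
def ProcessTree.InClassCa {α : Type*} (M : ProcessTree α) : Prop :=
  ∀ (op : Op) (ts : List (ProcessTree α)), Subtree (.node op ts) M →
    ts.Pairwise (fun s t => Disjoint s.activities t.activities) ∧
    (op = .loop → ∃ v : α, ts = [.act v, .tau]) ∧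
    (op ≠ .loop → ProcessTree.tau ∉ ts)

/-- Normal form with respect to the reduction rules `⊕(M) ↦ M` and
`⊕(…, ⊕(N₁, …, Nₖ), …) ↦ ⊕(…, N₁, …, Nₖ, …)` for choice, sequence and parallel nodes: every node
has at least two children, and no such node has a child with the same operator. -/
def ProcessTree.IsNormalForm {α : Type*} (M : ProcessTree α) : Prop :=
  ∀ (op : Op) (ts : List (ProcessTree α)), Subtree (.node op ts) M →
    2 ≤ ts.length ∧ (op ≠ .loop → ∀ us : List (ProcessTree α), ProcessTree.node op us ∉ ts)

/-- The reorderings of the children that an operator allows: all of them for choice and parallel,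
none for sequence, and those that fix the first child for loops. -/
inductive Reorder {β : Type*} : Op → List β → List β → Prop where
  | xor {ts us : List β} : ts.Perm us → Reorder .xor ts us
  | par {ts us : List β} : ts.Perm us → Reorder .par ts us
  | seq (ts : List β) : Reorder .seq ts ts
  | loop (t : β) {ts us : List β} : ts.Perm us → Reorder .loop (t :: ts) (t :: us)

/-- Isomorphism of process trees: syntactic equality up to reordering of the children of choice
and parallel nodes and of the non-first children of loop nodes. -/
inductive Isomorphic {α : Type*} : ProcessTree α → ProcessTree α → Prop where
  | tau : Isomorphic .tau .tau
  | act (a : α) : Isomorphic (.act a) (.act a)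
  | node {op : Op} {ts us vs : List (ProcessTree α)} :
      Reorder op ts us → List.Forall₂ Isomorphic us vs → Isomorphic (.node op ts) (.node op vs)

/-! ## Event logs and directly-follows graphs -/

/-- An event log: a finite multiset of traces. -/
abbrev EventLog (α : Type*) := Multiset (List α)

/-- Directly-follows graphs. An edge from the start symbol to `a` is recorded as `a ∈ start`, an
edge from `a` to the end symbol as `a ∈ finish`. -/
@[ext]
structure DFG (α : Type*) where
  activities : Set α
  start : Set α
  finish : Set α
  edge : α → α → Prop

/-- The directly-follows graph of a set of traces. -/
def dfgOf {α : Type*} (S : Set (List α)) : DFG α where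
  activities := {a | ∃ σ ∈ S, a ∈ σ}
  start := {a | ∃ σ ∈ S, σ.head? = some a}
  finish := {a | ∃ σ ∈ S, σ.getLast? = some a}
  edge a b := ∃ σ ∈ S, [a, b] <:+: σ

/-- The directly-follows graph `G(L)` of an event log. -/
def EventLog.dfg {α : Type*} (L : EventLog α) : DFG α := dfgOf {σ | σ ∈ L}

/-- The directly-follows graph `G(M) = G(ℒ(M))` of a process tree. -/
def ProcessTree.dfg {α : Type*} (M : ProcessTree α) : DFG α := dfgOf {σ | σ ∈ M.language}

/-- `L` and `M` are directly-follows complete. -/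
def DfComplete {α : Type*} (L : EventLog α) (M : ProcessTree α) : Prop :=
  EventLog.dfg L = M.dfg

/-! ## The Inductive Miner: cuts -/

/-- The condition that a list of parts has to meet to be a cut for the given operator. -/
def CutCondition {α : Type*} (G : DFG α) : Op → List (Set α) → Prop
  -- no edge between different parts
  | .xor, Ss => Ss.Pairwise (fun S T => ∀ a ∈ S, ∀ b ∈ T, ¬ G.edge a b ∧ ¬ G.edge b a)
  -- one can always go from an earlier part to a later part, and never back
  | .seq, Ss => Ss.Pairwise (fun S T => ∀ a ∈ S, ∀ b ∈ T,
      Relation.TransGen G.edge a b ∧ ¬ Relation.TransGen G.edge b a)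
  -- different parts are fully connected in both directions, and each part can start and end
  | .par, Ss => Ss.Pairwise (fun S T => ∀ a ∈ S, ∀ b ∈ T, G.edge a b ∧ G.edge b a) ∧
      ∀ S ∈ Ss, (S ∩ G.start).Nonempty ∧ (S ∩ G.finish).Nonempty
  | .loop, [] => False
  | .loop, body :: redos =>
      -- traces start and end in the body
      G.start ⊆ body ∧ G.finish ⊆ body ∧
      -- no edge between different redo parts
      redos.Pairwise (fun S T => ∀ a ∈ S, ∀ b ∈ T, ¬ G.edge a b ∧ ¬ G.edge b a) ∧
      ∀ S ∈ redos, ∀ r ∈ S,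
        -- the body is left for a redo part only from end activities, and from all or none of them
        (∀ b ∈ body, G.edge b r → b ∈ G.finish ∧ ∀ e ∈ G.finish, G.edge e r) ∧
        -- the body is entered from a redo part only in start activities, and in all or none of them
        (∀ b ∈ body, G.edge r b → b ∈ G.start ∧ ∀ s ∈ G.start, G.edge r s)

/-- A (nontrivial) cut: a partition of the activities into at least two nonempty parts that meets
the condition of the operator. -/
def IsCut {α : Type*} (G : DFG α) (op : Op) (Ss : List (Set α)) : Prop :=
  2 ≤ Ss.length ∧ (∀ S ∈ Ss, S.Nonempty) ∧ Ss.Pairwise Disjoint ∧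
    {a | ∃ S ∈ Ss, a ∈ S} = G.activities ∧ CutCondition G op Ss

/-- The graph has a cut for some operator. -/
def HasCut {α : Type*} (G : DFG α) : Prop := ∃ op Ss, IsCut G op Ss

/-- The order in which the Inductive Miner tries the operators. -/
def Op.rank : Op → ℕ
  | .xor => 0
  | .seq => 1
  | .par => 2
  | .loop => 3

/-- A cut that the Inductive Miner may select: a cut for the first operator that has one, with the
maximal number of parts among the cuts for this operator. -/
def SelectsCut {α : Type*} (G : DFG α) (op : Op) (Ss : List (Set α)) : Prop :=
  IsCut G op Ss ∧
    (∀ op' Ss', op'.rank < op.rank → ¬ IsCut G op' Ss') ∧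
    (∀ Ss', IsCut G op Ss' → Ss'.length ≤ Ss.length)

/-! ## The Inductive Miner: log splitting -/

open Classical in
/-- Projection of a trace to the activities in `S`. -/
noncomputable def project {α : Type*} (S : Set α) (σ : List α) : List α :=
  σ.filter (fun a => decide (a ∈ S))

open Classical in
/-- The maximal segments of a trace that consist of activities in `S`. -/
noncomputable def segments {α : Type*} (S : Set α) (σ : List α) : List (List α) :=
  (σ.splitBy (fun a b => decide (a ∈ S ↔ b ∈ S))).filter (fun τ => decide (∀ a ∈ τ, a ∈ S))

open Classical in
/-- Splitting of a log along one part of a cut. Each nonempty trace goes to the part that it lies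
in (choice), is projected to the part (sequence, parallel; for a sequence cut, the projection of a
trace to a part is a segment of the trace), or is cut into its maximal segments (loop). -/
noncomputable def splitLog {α : Type*} (L : EventLog α) (S : Set α) : Op → EventLog α
  | .xor => L.filter (fun σ => ∀ a ∈ σ, a ∈ S)
  | .seq => L.map (project S)
  | .par => L.map (project S)
  | .loop => L.bind (fun σ => (segments S σ : Multiset (List α)))

open Classical in
/-- Splits each trace between an end activity and a start activity that directly follow each
other. -/
noncomputable def strictTauSplit {α : Type*} (L : EventLog α) : EventLog α :=
  L.bind (fun σ => (σ.splitBy (fun a b =>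
    decide (¬ (a ∈ (EventLog.dfg L).finish ∧ b ∈ (EventLog.dfg L).start))) : Multiset (List α)))

open Classical in
/-- Splits each trace before each start activity. -/
noncomputable def tauSplit {α : Type*} (L : EventLog α) : EventLog α :=
  L.bind (fun σ => (σ.splitBy (fun _ b =>
    decide (b ∉ (EventLog.dfg L).start)) : Multiset (List α)))

/-! ## The Inductive Miner: algorithm -/

/-- The log has at least one trace, and all its traces are `⟨a⟩`. -/
def IsSingleActivity {α : Type*} (L : EventLog α) (a : α) : Prop :=
  L ≠ 0 ∧ ∀ σ ∈ L, σ = [a]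

/-- Cut detection is reached: there is no empty trace, and no base case applies. -/
def ReachesCuts {α : Type*} (L : EventLog α) : Prop :=
  L ≠ 0 ∧ [] ∉ L ∧ ∀ a, ¬ IsSingleActivity L a

/-- The fall throughs (other than the one for empty traces) are reached: no cut exists. -/
def ReachesFallThroughs {α : Type*} (L : EventLog α) : Prop :=
  ReachesCuts L ∧ ¬ HasCut (EventLog.dfg L)

/-- The activity `a` occurs exactly once in each trace. -/
def OncePerTrace {α : Type*} (L : EventLog α) (a : α) : Prop :=
  ∀ σ ∈ L, project {a} σ = [a]

/-- After leaving out the activity `a` of the log, a cut exists. -/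
def ConcurrentActivity {α : Type*} (L : EventLog α) (a : α) : Prop :=
  a ∈ (EventLog.dfg L).activities ∧ HasCut (EventLog.dfg (L.map (project {a}ᶜ)))

/-- The strict tau loop applies: splitting the traces yields more traces. -/
def HasStrictTauLoop {α : Type*} (L : EventLog α) : Prop :=
  L.card < (strictTauSplit L).card

/-- The tau loop applies: splitting the traces yields more traces. -/
def HasTauLoop {α : Type*} (L : EventLog α) : Prop :=
  L.card < (tauSplit L).card

open Classical in
/-- `InductiveMiner L M`: a run of the Inductive Miner (with fall throughs) on the event log `L`
terminates with the process tree `M`. A step takes the first alternative that applies among: the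
base cases, the fall through for empty traces, the cuts, and the other fall throughs in the order
below. The algorithm leaves open in which order the children of choice and parallel nodes are
listed and which cut or activity is taken if several qualify; every choice is a run. -/
inductive InductiveMiner {α : Type*} : EventLog α → ProcessTree α → Prop where
  /-- Base case: the log contains no event. -/
  | noEvents {L : EventLog α} (h : ∀ σ ∈ L, σ = []) : InductiveMiner L .tau
  /-- Base case: the log consists of traces `⟨a⟩`. -/
  | singleActivity {L : EventLog α} {a : α} (h : IsSingleActivity L a) :
      InductiveMiner L (.act a)
  /-- Fall through "Empty Traces". -/
  | emptyTraces {L : EventLog α} {M : ProcessTree α}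
      (h : [] ∈ L) (h' : ∃ σ ∈ L, σ ≠ [])
      (hM : InductiveMiner (L.filter (fun σ => σ ≠ [])) M) :
      InductiveMiner L (.node .xor [.tau, M])
  /-- Cuts: split the log along a cut and recur on the sublogs. -/
  | cut {L : EventLog α} {op : Op} {Ss : List (Set α)} {Ms : List (ProcessTree α)}
      (h : ReachesCuts L) (hcut : SelectsCut (EventLog.dfg L) op Ss)
      (hMs : List.Forall₂ InductiveMiner (Ss.map (fun S => splitLog L S op)) Ms) :
      InductiveMiner L (.node op Ms)
  /-- Fall through "Activity Once Per Trace". -/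
  | activityOncePerTrace {L : EventLog α} {a : α} {M : ProcessTree α}
      (h : ReachesFallThroughs L) (ha : OncePerTrace L a)
      (hM : InductiveMiner (L.map (project {a}ᶜ)) M) :
      InductiveMiner L (.node .par [.act a, M])
  /-- Fall through "Activity Concurrent". -/
  | activityConcurrent {L : EventLog α} {a : α} {M N : ProcessTree α}
      (h : ReachesFallThroughs L) (h₁ : ∀ b, ¬ OncePerTrace L b)
      (ha : ConcurrentActivity L a)
      (hM : InductiveMiner (L.map (project {a})) M)
      (hN : InductiveMiner (L.map (project {a}ᶜ)) N) :
      InductiveMiner L (.node .par [M, N])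
  /-- Fall through "Strict Tau Loop". -/
  | strictTauLoop {L : EventLog α} {M : ProcessTree α}
      (h : ReachesFallThroughs L) (h₁ : ∀ b, ¬ OncePerTrace L b)
      (h₂ : ∀ b, ¬ ConcurrentActivity L b) (hl : HasStrictTauLoop L)
      (hM : InductiveMiner (strictTauSplit L) M) :
      InductiveMiner L (.node .loop [M, .tau])
  /-- Fall through "Tau Loop". -/
  | tauLoop {L : EventLog α} {M : ProcessTree α}
      (h : ReachesFallThroughs L) (h₁ : ∀ b, ¬ OncePerTrace L b)
      (h₂ : ∀ b, ¬ ConcurrentActivity L b) (h₃ : ¬ HasStrictTauLoop L) (hl : HasTauLoop L)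
      (hM : InductiveMiner (tauSplit L) M) :
      InductiveMiner L (.node .loop [M, .tau])
  /-- Fall through "Flower Model". -/
  | flowerModel {L : EventLog α} {as : List α}
      (h : ReachesFallThroughs L) (h₁ : ∀ b, ¬ OncePerTrace L b)
      (h₂ : ∀ b, ¬ ConcurrentActivity L b) (h₃ : ¬ HasStrictTauLoop L) (h₄ : ¬ HasTauLoop L)
      (hnodup : as.Nodup) (has : {a | a ∈ as} = (EventLog.dfg L).activities) :
      InductiveMiner L (.node .loop [.node .xor (as.map .act), .tau])

end ProcessDiscovery

open ProcessDiscovery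

namespace ProcessDiscovery

-- A tree of class `C_a` in normal form is `τ`, or is built from leaves and self-loops by choice,
-- sequence and parallel nodes with disjoint children (`IsReduced`). The proof is by induction on
-- this structure, for all fitting and complete logs at once, since the miner recurs on sublogs.
--
-- The heart is that the graph of a node `op(ts)` determines its children. Activities in different
-- parts of a choice, sequence or parallel cut are related by `Separates`: neither, exactly one, or
-- each of them reaches the other. These relations exclude each other. Hence activities in different
-- parts of a cut for one operator must share a part of any cut for another operator. A cut has at
-- least two parts, so activities of the same part are linked through another part
-- (`rel_of_rel_across`) and all activities would share a part. So a graph has cuts for at most one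
-- non-loop operator (`IsCut.op_unique`).
--
-- The same argument inside a child, whose operator differs from `op` by normal form, puts the whole
-- child into one part of any `op`-cut of the node (`exists_part_of_child`). It needs that
-- `op`-separation in the graph of the node descends to the graph of the child
-- (`separates_of_node`). So the children refine every `op`-cut, and a cut with the maximal number
-- of parts consists exactly of the children; for sequences reachability also fixes their order
-- (`SelectsCut.eq_node`).
--
-- Splitting along the children preserves fitness and completeness (`mem_language_of_mem_splitLog`,
-- `dfComplete_splitLog`), so the induction hypothesis applies to the sublogs. A self-loop admits no
-- cut, since it has one activity; the earlier fall-throughs fail and the strict tau loop cuts the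
-- log into single events (`IsSelfLoopLog.eq_selfLoop`).

/-! ## Lists of disjoint parts -/

/-- A transitive relation that holds across different parts holds everywhere, as soon as there
are two parts. -/
theorem rel_of_rel_across {α : Type*} {Bs : List (Set α)} (h2 : 2 ≤ Bs.length)
    (hne : ∀ B ∈ Bs, B.Nonempty) (hd : Bs.Pairwise Disjoint) {r : α → α → Prop}
    (htrans : ∀ a b c, r a b → r b c → r a c)
    (hr : ∀ B ∈ Bs, ∀ C ∈ Bs, B ≠ C → ∀ b ∈ B, ∀ c ∈ C, r b c)
    {B C : Set α} (hB : B ∈ Bs) (hC : C ∈ Bs) {b c : α} (hb : b ∈ B) (hc : c ∈ C) : r b c := by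
  by_cases hBC : B = C
  · subst hBC
    -- Two elements of the same part are linked through an element of another part; the first two
    -- parts differ, so one of them is not `B`.
    obtain ⟨D, hD, hDB⟩ : ∃ D ∈ Bs, D ≠ B := by
      match Bs, h2, hne, hd with
      | S :: T :: _, _, hne, hd =>
        have hST : S ≠ T := by
          rintro rfl
          have h : Disjoint S S := (List.pairwise_cons.1 hd).1 S (by simp)
          exact (hne S (by simp)).ne_empty (disjoint_self.1 h)
        by_cases h : S = B
        · exact ⟨T, by simp, fun h' => hST (h.trans h'.symm)⟩
        · exact ⟨S, by simp, h⟩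
    obtain ⟨d, hd'⟩ := hne D hD
    exact htrans b d c (hr B hB D hD hDB.symm b hb d hd') (hr D hD B hB hDB d hd' c hc)
  · exact hr B hB C hC hBC b hb c hc

theorem eq_of_mem_of_mem {α : Type*} {Ss : List (Set α)} (hd : Ss.Pairwise Disjoint)
    {S T : Set α} (hS : S ∈ Ss) (hT : T ∈ Ss) {a : α} (haS : a ∈ S) (haT : a ∈ T) : S = T := by
  by_contra hne
  exact Set.disjoint_left.1 (hd.forall hS hT hne) haS haT

theorem nodup_of_pairwise_disjoint {α : Type*} {Ss : List (Set α)} (hd : Ss.Pairwise Disjoint)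
    (hne : ∀ S ∈ Ss, S.Nonempty) : Ss.Nodup := by
  refine (List.Pairwise.and_mem.1 hd).imp ?_
  rintro S T ⟨hS, -, h⟩ rfl
  exact (hne S hS).ne_empty (disjoint_self.1 h)

/-- If the parts `Bs` refine the parts `Ss`, then `Ss` has at most as many parts as `Bs`, and the
same parts if it has equally many. -/
theorem length_le_and_perm_of_refines {α : Type*} {Ss Bs : List (Set α)}
    (hSd : Ss.Pairwise Disjoint) (hSne : ∀ S ∈ Ss, S.Nonempty)
    (hBd : Bs.Pairwise Disjoint) (hBne : ∀ B ∈ Bs, B.Nonempty)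
    (hU : {a | ∃ S ∈ Ss, a ∈ S} = {a | ∃ B ∈ Bs, a ∈ B})
    (hsub : ∀ B ∈ Bs, ∃ S ∈ Ss, B ⊆ S) :
    Ss.length ≤ Bs.length ∧ (Bs.length ≤ Ss.length → Ss.Perm Bs) := by
  classical
  have hSn := nodup_of_pairwise_disjoint hSd hSne
  have hBn := nodup_of_pairwise_disjoint hBd hBne
  choose! f hf hfsub using hsub
  have hcover : ∀ S ∈ Ss, ∀ a ∈ S, ∃ B ∈ Bs, a ∈ B ∧ f B = S := by
    intro S hS a ha
    have h : a ∈ {a | ∃ S ∈ Ss, a ∈ S} := ⟨S, hS, ha⟩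
    rw [hU] at h
    obtain ⟨B, hB, haB⟩ := h
    exact ⟨B, hB, haB, eq_of_mem_of_mem hSd (hf B hB) hS (hfsub B hB haB) ha⟩
  have himage : Bs.toFinset.image f = Ss.toFinset := by
    ext S
    simp only [Finset.mem_image, List.mem_toFinset]
    constructor
    · rintro ⟨B, hB, rfl⟩
      exact hf B hB
    · intro hS
      obtain ⟨a, ha⟩ := hSne S hS
      obtain ⟨B, hB, -, h⟩ := hcover S hS a ha
      exact ⟨B, hB, h⟩
  rw [← List.toFinset_card_of_nodup hSn, ← List.toFinset_card_of_nodup hBn, ← himage]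
  refine ⟨Finset.card_image_le, fun hle => ?_⟩
  have hinj := Finset.card_image_iff.1 (le_antisymm Finset.card_image_le hle)
  -- `f` maps onto `Ss`, and is injective once the lengths agree. An element of `f B` lies in some
  -- `C` with `f C = f B`, which must then be `B`.
  have hfix : ∀ B ∈ Bs, f B = B := by
    intro B hB
    refine Set.Subset.antisymm (fun a ha => ?_) (hfsub B hB)
    obtain ⟨C, hC, haC, h⟩ := hcover (f B) (hf B hB) a ha
    rwa [← hinj (by simpa using hC) (by simpa using hB) h]
  refine List.perm_of_nodup_nodup_toFinset_eq hSn hBn ?_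
  rw [← himage]
  ext S
  simp only [Finset.mem_image, List.mem_toFinset]
  constructor
  · rintro ⟨B, hB, rfl⟩
    rwa [hfix B hB]
  · exact fun hS => ⟨S, hS, hfix S hS⟩

theorem pairwise_of_append {β : Type*} {R : β → β → Prop} : ∀ {l : List β},
    (∀ l₁ l₂, l = l₁ ++ l₂ → ∀ x ∈ l₁, ∀ y ∈ l₂, R x y) → l.Pairwise R
  | [], _ => .nil
  | x :: l, h => by
    refine List.pairwise_cons.2 ⟨fun y hy => h [x] l rfl x (by simp) y hy,
      pairwise_of_append fun l₁ l₂ hl x' hx' y hy => ?_⟩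
    exact h (x :: l₁) l₂ (by simp [hl]) x' (by simp [hx']) y hy

/-! ## Cuts of directly-follows graphs -/

/-- The relation between activities of different parts of a cut; for choices and sequences, in
terms of reachability. -/
def Separates {α : Type*} (G : DFG α) : Op → α → α → Prop
  | .xor, a, b => ¬ Relation.TransGen G.edge a b ∧ ¬ Relation.TransGen G.edge b a
  | .seq, a, b => (Relation.TransGen G.edge a b ∧ ¬ Relation.TransGen G.edge b a) ∨
      (Relation.TransGen G.edge b a ∧ ¬ Relation.TransGen G.edge a b)
  | .par, a, b => G.edge a b ∧ G.edge b a
  | .loop, _, _ => False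

theorem Separates.symm {α : Type*} {G : DFG α} {op : Op} {a b : α} (h : Separates G op a b) :
    Separates G op b a := by
  cases op <;> simp only [Separates] at h ⊢ <;> tauto

/-- Mutual edges give mutual reachability, so the relations for choice, sequence and parallel
require paths in no, exactly one, and both directions. -/
theorem Separates.op_unique {α : Type*} {G : DFG α} {op op' : Op} {a b : α}
    (h : Separates G op a b) (h' : Separates G op' a b) : op = op' := by
  have h1 : G.edge a b → Relation.TransGen G.edge a b := .single
  have h2 : G.edge b a → Relation.TransGen G.edge b a := .single
  cases op <;> cases op' <;> simp only [Separates] at h h' <;> first | rfl | (exfalso; tauto)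

theorem IsCut.mem_activities {α : Type*} {G : DFG α} {op : Op} {Ss : List (Set α)}
    (h : IsCut G op Ss) {S : Set α} (hS : S ∈ Ss) {a : α} (ha : a ∈ S) : a ∈ G.activities := by
  rw [← h.2.2.2.1]
  exact ⟨S, hS, ha⟩

theorem IsCut.exists_mem {α : Type*} {G : DFG α} {op : Op} {Ss : List (Set α)}
    (h : IsCut G op Ss) {a : α} (ha : a ∈ G.activities) : ∃ S ∈ Ss, a ∈ S := by
  rwa [← h.2.2.2.1] at ha

theorem IsCut.eq_of_mem {α : Type*} {G : DFG α} {op : Op} {Ss : List (Set α)}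
    (h : IsCut G op Ss) {S T : Set α} (hS : S ∈ Ss) (hT : T ∈ Ss) {a : α} (haS : a ∈ S)
    (haT : a ∈ T) : S = T :=
  eq_of_mem_of_mem h.2.2.1 hS hT haS haT

/-- The target of an edge lies in some part by `hG`, and no edge joins different parts, so each part
is closed under successors. This upgrades the edge condition of a choice cut to reachability, as
`Separates` needs. -/
theorem IsCut.mem_of_transGen {α : Type*} {G : DFG α} (hG : ∀ a b, G.edge a b → b ∈ G.activities)
    {Ss : List (Set α)} (h : IsCut G .xor Ss) {S : Set α} (hS : S ∈ Ss) {a b : α} (ha : a ∈ S)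
    (hab : Relation.TransGen G.edge a b) : b ∈ S := by
  have step : ∀ a ∈ S, ∀ b, G.edge a b → b ∈ S := by
    intro a ha b hab
    obtain ⟨T, hT, hbT⟩ := h.exists_mem (hG a b hab)
    by_cases hST : S = T
    · rwa [hST]
    · have hcond : Ss.Pairwise fun S T => ∀ a ∈ S, ∀ b ∈ T, ¬ G.edge a b ∧ ¬ G.edge b a :=
        h.2.2.2.2
      have : Std.Symm (fun S T : Set α => ∀ a ∈ S, ∀ b ∈ T, ¬ G.edge a b ∧ ¬ G.edge b a) :=
        ⟨fun S T h a ha b hb => (h b hb a ha).symm⟩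
      exact absurd hab (hcond.forall hS hT hST a ha b hbT).1
  induction hab with
  | single h => exact step _ ha _ h
  | tail _ h ih => exact step _ ih _ h

theorem IsCut.separates {α : Type*} {G : DFG α} (hG : ∀ a b, G.edge a b → b ∈ G.activities)
    {op : Op} (hop : op ≠ .loop) {Ss : List (Set α)} (h : IsCut G op Ss) {S T : Set α}
    (hS : S ∈ Ss) (hT : T ∈ Ss) (hST : S ≠ T) {a b : α} (ha : a ∈ S) (hb : b ∈ T) :
    Separates G op a b := by
  have : Std.Symm (fun S T : Set α => ∀ a ∈ S, ∀ b ∈ T, Separates G op a b) :=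
    ⟨fun S T h a ha b hb => (h b hb a ha).symm⟩
  cases op with
  | xor =>
    exact ⟨fun hab => hST (h.eq_of_mem hS hT (h.mem_of_transGen hG hS ha hab) hb),
      fun hba => hST (h.eq_of_mem hS hT ha (h.mem_of_transGen hG hT hb hba))⟩
  | seq =>
    have hcond : Ss.Pairwise (fun S T => ∀ a ∈ S, ∀ b ∈ T, Separates G .seq a b) :=
      List.Pairwise.imp (fun h a ha b hb => Or.inl (h a ha b hb)) h.2.2.2.2
    exact hcond.forall hS hT hST a ha b hb
  | par =>
    have hcond : Ss.Pairwise (fun S T => ∀ a ∈ S, ∀ b ∈ T, Separates G .par a b) := h.2.2.2.2.1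
    exact hcond.forall hS hT hST a ha b hb
  | loop => exact absurd rfl hop

/-- Activities that are not separated lie in the same part of each cut. -/
theorem IsCut.mem_of_not_separates {α : Type*} {G : DFG α}
    (hG : ∀ a b, G.edge a b → b ∈ G.activities) {op : Op} (hop : op ≠ .loop)
    {Ss : List (Set α)} (h : IsCut G op Ss) {a b : α} (hb : b ∈ G.activities)
    (hab : ¬ Separates G op a b) : ∀ S ∈ Ss, a ∈ S → b ∈ S := by
  intro S hS ha
  obtain ⟨T, hT, hbT⟩ := h.exists_mem hb
  by_cases hST : S = T
  · rwa [hST]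
  · exact absurd (h.separates hG hop hS hT hST ha hbT) hab

/-- A graph has choice, sequence or parallel cuts for at most one of these operators. -/
theorem IsCut.op_unique {α : Type*} {G : DFG α} (hG : ∀ a b, G.edge a b → b ∈ G.activities)
    {op op' : Op} (hop : op ≠ .loop) (hop' : op' ≠ .loop) {Ss Ts : List (Set α)}
    (h : IsCut G op Ss) (h' : IsCut G op' Ts) : op = op' := by
  by_contra hne
  -- All activities share one part of `Ts`, which contradicts its having two nonempty disjoint
  -- parts.
  have key : ∀ a ∈ G.activities, ∀ b ∈ G.activities, ∀ T ∈ Ts, a ∈ T → b ∈ T := by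
    intro a ha b hb
    obtain ⟨A, hA, haA⟩ := h.exists_mem ha
    obtain ⟨B, hB, hbB⟩ := h.exists_mem hb
    refine rel_of_rel_across (r := fun a b => ∀ T ∈ Ts, a ∈ T → b ∈ T) h.1 h.2.1 h.2.2.1
      (fun a b c h₁ h₂ T hT ha => h₂ T hT (h₁ T hT ha)) ?_ hA hB haA hbB
    intro S hS T hT hST a ha b hb
    exact h'.mem_of_not_separates hG hop' (h.mem_activities hT hb)
      fun hsep => hne ((h.separates hG hop hS hT hST ha hb).op_unique hsep)
  obtain ⟨h2, hne', hd, -, -⟩ := id h'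
  match Ts, h2, hne', hd, h', key with
  | S :: T :: _, _, hne', hd, h', key =>
    obtain ⟨a, ha⟩ := hne' S (by simp)
    obtain ⟨b, hb⟩ := hne' T (by simp)
    have hST := (List.pairwise_cons.1 hd).1 T (by simp)
    exact Set.disjoint_left.1 hST (key a (h'.mem_activities (by simp) ha) b
      (h'.mem_activities (by simp) hb) S (by simp) ha) hb

/-- Two sequence cuts with the same parts are equal. -/
theorem IsCut.eq_of_perm {α : Type*} {G : DFG α} {Ss Ts : List (Set α)}
    (h : IsCut G .seq Ss) (h' : IsCut G .seq Ts) (hperm : Ss.Perm Ts) : Ss = Ts := by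
  -- One-way reachability is antisymmetric on nonempty parts, so it admits only one ordering of
  -- them.
  refine List.Perm.eq_of_pairwise (fun S T hS hT h₁ h₂ => ?_) h.2.2.2.2 h'.2.2.2.2 hperm
  obtain ⟨a, ha⟩ := h.2.1 S hS
  obtain ⟨b, hb⟩ := h'.2.1 T hT
  exact absurd (h₁ a ha b hb).1 (h₂ b hb a ha).2

/-! ## Directly-follows graphs of sets of traces -/

theorem dfgOf_mem_of_edge {α : Type*} {S : Set (List α)} {a b : α} (h : (dfgOf S).edge a b) :
    a ∈ (dfgOf S).activities ∧ b ∈ (dfgOf S).activities := by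
  obtain ⟨σ, hσ, h⟩ := h
  exact ⟨⟨σ, hσ, h.subset (by simp)⟩, ⟨σ, hσ, h.subset (by simp)⟩⟩

theorem dfgOf_edge_mem {α : Type*} {S : Set (List α)} (a b : α) (h : (dfgOf S).edge a b) :
    b ∈ (dfgOf S).activities :=
  (dfgOf_mem_of_edge h).2

/-- Walks along the trace from `a` to a later event; `p` collects the events already passed. -/
theorem transGen_of_append {α : Type*} {S : Set (List α)} : ∀ (l p : List α) {a b : α},
    p ++ a :: l ∈ S → b ∈ l → Relation.TransGen (dfgOf S).edge a b
  | c :: l, p, a, b, hS, hb => by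
    have hac : (dfgOf S).edge a c := ⟨_, hS, p, l, by simp⟩
    rcases List.mem_cons.1 hb with rfl | hb
    · exact .single hac
    · exact .head hac (transGen_of_append l (p ++ [a]) (by simpa using hS) hb)

theorem transGen_of_mem_append {α : Type*} {S : Set (List α)} {x y : List α} {a b : α}
    (hS : x ++ y ∈ S) (ha : a ∈ x) (hb : b ∈ y) : Relation.TransGen (dfgOf S).edge a b := by
  obtain ⟨p, q, rfl⟩ := List.append_of_mem ha
  exact transGen_of_append (q ++ y) p (by simpa using hS) (by simp [hb])

/-- Reachability between two activities restricts to a set of activities that contains all paths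
between them. -/
theorem transGen_restrict {α : Type*} {G H : DFG α} {A : Set α} {a b : α}
    (hedge : ∀ c ∈ A, ∀ d ∈ A, G.edge c d → H.edge c d) (ha : a ∈ A) (hb : b ∈ A)
    (hconv : ∀ a ∈ A, ∀ c, Relation.TransGen G.edge a c → Relation.TransGen G.edge c b → c ∈ A)
    (h : Relation.TransGen G.edge a b) : Relation.TransGen H.edge a b := by
  -- Induction from the head keeps the target `b` fixed, so that `hconv` applies to each
  -- intermediate activity.
  induction h using Relation.TransGen.head_induction_on with
  | single h => exact .single (hedge _ ha _ hb h)
  | head h h' ih =>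
    have hc := hconv _ ha _ (.single h) h'
    exact .head (hedge _ ha _ hc h) (ih hc)

/-! ## Projections -/

theorem project_append {α : Type*} (S : Set α) (x y : List α) :
    project S (x ++ y) = project S x ++ project S y := by
  simp [project]

theorem project_eq_self {α : Type*} {S : Set α} {x : List α} (h : ∀ a ∈ x, a ∈ S) :
    project S x = x := by
  simpa [project] using h

theorem project_eq_nil {α : Type*} {S : Set α} {x : List α} (h : ∀ a ∈ x, a ∉ S) :
    project S x = [] := by
  simpa [project] using h

theorem mem_project {α : Type*} {S : Set α} {x : List α} {a : α} :
    a ∈ project S x ↔ a ∈ x ∧ a ∈ S := by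
  simp [project]

theorem project_cons_of_mem {α : Type*} {S : Set α} {x : List α} {a : α} (h : a ∈ S) :
    project S (a :: x) = a :: project S x := by
  simp [project, h]

theorem project_cons_of_notMem {α : Type*} {S : Set α} {x : List α} {a : α} (h : a ∉ S) :
    project S (a :: x) = project S x := by
  simp [project, h]

theorem infix_project {α : Type*} {S : Set α} {x : List α} {a b : α} (ha : a ∈ S) (hb : b ∈ S)
    (h : [a, b] <:+: x) : [a, b] <:+: project S x := by
  obtain ⟨p, q, rfl⟩ := h
  exact ⟨project S p, project S q, by
    rw [project_append, project_append, project_eq_self (x := [a, b])]; simp [ha, hb]⟩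

/-- A trace is an interleaving of its projections to two complementary sets of activities. -/
theorem interleaving_project {α : Type*} {S T : Set α} (hd : Disjoint S T) : ∀ {z : List α},
    (∀ a ∈ z, a ∈ S ∨ a ∈ T) → Interleaving (project S z) (project T z) z
  | [], _ => by simpa [project] using Interleaving.nil
  | a :: z, h => by
    have ih := interleaving_project hd (z := z) fun b hb => h b (by simp [hb])
    rcases h a (by simp) with ha | ha
    · rw [project_cons_of_mem ha, project_cons_of_notMem (Set.disjoint_left.1 hd ha)]
      exact .left a ih
    · rw [project_cons_of_mem ha, project_cons_of_notMem (Set.disjoint_right.1 hd ha)]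
      exact .right a ih

theorem Interleaving.mem {α : Type*} {x y z : List α} (h : Interleaving x y z) {a : α} :
    a ∈ z ↔ a ∈ x ∨ a ∈ y := by
  induction h <;> simp_all [or_assoc, or_left_comm]

/-- Recovers the components of an interleaving over disjoint activities, conversely to
`interleaving_project`. -/
theorem Interleaving.project_append {α : Type*} {S : Set α} {x y z : List α}
    (h : Interleaving x y z) :
    ((∀ a ∈ y, a ∉ S) → project S z = project S x) ∧
      ((∀ a ∈ x, a ∉ S) → project S z = project S y) := by
  induction h with
  | nil => simp
  | left a _ ih =>
    refine ⟨fun hy => ?_, fun hx => ?_⟩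
    · by_cases ha : a ∈ S
      · rw [project_cons_of_mem ha, project_cons_of_mem ha, ih.1 hy]
      · rw [project_cons_of_notMem ha, project_cons_of_notMem ha, ih.1 hy]
    · rw [project_cons_of_notMem (hx a (by simp)), ih.2 fun b hb => hx b (by simp [hb])]
  | right a _ ih =>
    refine ⟨fun hy => ?_, fun hx => ?_⟩
    · rw [project_cons_of_notMem (hy a (by simp)), ih.1 fun b hb => hy b (by simp [hb])]
    · by_cases ha : a ∈ S
      · rw [project_cons_of_mem ha, project_cons_of_mem ha, ih.2 hx]
      · rw [project_cons_of_notMem ha, project_cons_of_notMem ha, ih.2 hx]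

/-! ## Activities and languages of process trees -/

theorem activities_act {α : Type*} (a : α) : (ProcessTree.act a).activities = {a} := by
  ext b
  constructor
  · intro h
    cases (h : Subtree (.act b) (.act a))
    rfl
  · rintro rfl
    exact Subtree.refl

theorem activities_tau {α : Type*} : (ProcessTree.tau : ProcessTree α).activities = ∅ := by
  ext b
  constructor
  · intro h
    cases (h : Subtree (.act b) .tau)
  · exact False.elim

theorem mem_activities_node {α : Type*} {op : Op} {ts : List (ProcessTree α)} {a : α} :
    a ∈ (ProcessTree.node op ts).activities ↔ ∃ t ∈ ts, a ∈ t.activities := by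
  constructor
  · intro h
    cases (h : Subtree (.act a) (.node op ts)) with
    | child ht h => exact ⟨_, ht, h⟩
  · rintro ⟨t, ht, h⟩
    exact Subtree.child ht h

theorem mem_language_xor {α : Type*} {σ : List α} : ∀ {ts : List (ProcessTree α)},
    σ ∈ (ProcessTree.node .xor ts).language ↔ ∃ t ∈ ts, σ ∈ t.language
  | [] => by
    simp only [ProcessTree.language, ProcessTree.languages, Op.combine, List.sum_nil]
    simp
  | t :: ts => by
    have ih := mem_language_xor (σ := σ) (ts := ts)
    simp only [ProcessTree.language, ProcessTree.languages, Op.combine, List.sum_cons,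
      Language.mem_add, List.exists_mem_cons_iff] at ih ⊢
    rw [ih]

theorem mem_language_seq_nil {α : Type*} {σ : List α} :
    σ ∈ (ProcessTree.node .seq []).language ↔ σ = [] := by
  simp [ProcessTree.language, ProcessTree.languages, Op.combine, Language.mem_one]

theorem mem_language_seq_cons {α : Type*} {σ : List α} {t : ProcessTree α}
    {ts : List (ProcessTree α)} :
    σ ∈ (ProcessTree.node .seq (t :: ts)).language ↔
      ∃ x ∈ t.language, ∃ y ∈ (ProcessTree.node .seq ts).language, x ++ y = σ := by
  simp only [ProcessTree.language, ProcessTree.languages, Op.combine, List.prod_cons,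
    Language.mem_mul]

theorem mem_language_seq_append {α : Type*} {σ : List α} {us : List (ProcessTree α)} :
    ∀ {ts : List (ProcessTree α)}, σ ∈ (ProcessTree.node .seq (ts ++ us)).language ↔
      ∃ x ∈ (ProcessTree.node .seq ts).language,
        ∃ y ∈ (ProcessTree.node .seq us).language, x ++ y = σ := by
  intro ts
  induction ts generalizing σ with
  | nil => simp [mem_language_seq_nil]
  | cons t ts ih =>
    simp only [List.cons_append, mem_language_seq_cons, ih]
    constructor
    · rintro ⟨x, hx, _, ⟨y, hy, z, hz, rfl⟩, rfl⟩
      exact ⟨x ++ y, ⟨x, hx, y, hy, rfl⟩, z, hz, by simp⟩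
    · rintro ⟨_, ⟨x, hx, y, hy, rfl⟩, z, hz, rfl⟩
      exact ⟨x, hx, y ++ z, ⟨y, hy, z, hz, rfl⟩, by simp⟩

theorem mem_language_par_nil {α : Type*} {σ : List α} :
    σ ∈ (ProcessTree.node .par []).language ↔ σ = [] := by
  simp [ProcessTree.language, ProcessTree.languages, Op.combine, Language.mem_one]

theorem mem_language_par_cons {α : Type*} {σ : List α} {t : ProcessTree α}
    {ts : List (ProcessTree α)} :
    σ ∈ (ProcessTree.node .par (t :: ts)).language ↔
      ∃ x ∈ t.language, ∃ y ∈ (ProcessTree.node .par ts).language, Interleaving x y σ := by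
  simp only [ProcessTree.language, ProcessTree.languages, Op.combine, List.foldr_cons]
  rfl

open Computability in
theorem mem_language_selfLoop {α : Type*} {v : α} {σ : List α} :
    σ ∈ (ProcessTree.node .loop [.act v, .tau]).language ↔ σ ≠ [] ∧ ∀ a ∈ σ, a = v := by
  -- The redo part `τ` contributes only the empty trace.
  have h : (ProcessTree.node .loop [.act v, .tau]).language = {[v]} * ({[v]} : Language α)∗ := by
    simp [ProcessTree.language, ProcessTree.languages, Op.combine]
  rw [h, Language.mem_mul]
  constructor
  · rintro ⟨x, hx, y, hy, rfl⟩
    rw [Set.mem_singleton_iff.1 hx]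
    obtain ⟨l, rfl, hl⟩ := Language.mem_kstar.1 hy
    refine ⟨by simp, fun a ha => ?_⟩
    rcases List.mem_append.1 ha with ha | ha
    · simpa using ha
    · obtain ⟨w, hw, haw⟩ := List.mem_flatten.1 ha
      rw [Set.mem_singleton_iff.1 (hl w hw)] at haw
      simpa using haw
  · rintro ⟨hne, h⟩
    obtain ⟨a, l, rfl⟩ := List.exists_cons_of_ne_nil hne
    refine ⟨[v], rfl, l, Language.mem_kstar.2 ⟨l.map fun a => [a], ?_, ?_⟩, ?_⟩
    · simp [← List.flatMap_def]
    · intro y hy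
      obtain ⟨b, hb, rfl⟩ := List.mem_map.1 hy
      rw [h b (by simp [hb])]
      rfl
    · simp [h a (by simp)]

/-- Every trace is nonempty and consists of activities of the tree, and every activity of the tree
occurs in a trace. -/
structure ProcessTree.IsProper {α : Type*} (t : ProcessTree α) : Prop where
  nil_notMem : [] ∉ t.language
  mem_activities : ∀ σ ∈ t.language, ∀ a ∈ σ, a ∈ t.activities
  exists_mem : ∀ a ∈ t.activities, ∃ σ ∈ t.language, a ∈ σ
  nonempty : t.activities.Nonempty

/-- Pairwise disjointness of the sets of activities. -/
abbrev DisjointActivities {α : Type*} (ts : List (ProcessTree α)) : Prop :=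
  ts.Pairwise fun s t => Disjoint s.activities t.activities

theorem DisjointActivities.eq_of_mem {α : Type*} {ts : List (ProcessTree α)}
    (hd : DisjointActivities ts) {s t : ProcessTree α} (hs : s ∈ ts) (ht : t ∈ ts) {a : α}
    (has : a ∈ s.activities) (hat : a ∈ t.activities) : s = t := by
  have : Std.Symm (fun s t : ProcessTree α => Disjoint s.activities t.activities) :=
    ⟨fun _ _ h => h.symm⟩
  by_contra hne
  exact Set.disjoint_left.1 (List.Pairwise.forall hd hs ht hne) has hat

theorem ProcessTree.IsProper.exists_language {α : Type*} {t : ProcessTree α} (h : t.IsProper) :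
    ∃ σ, σ ∈ t.language := by
  obtain ⟨a, ha⟩ := h.nonempty
  obtain ⟨σ, hσ, -⟩ := h.exists_mem a ha
  exact ⟨σ, hσ⟩

theorem exists_activities_of_mem_language {α : Type*} {op : Op} (hop : op ≠ .loop) :
    ∀ {ts : List (ProcessTree α)}, (∀ t ∈ ts, t.IsProper) →
    ∀ {σ : List α}, σ ∈ (ProcessTree.node op ts).language → ∀ a ∈ σ,
      ∃ t ∈ ts, a ∈ t.activities := by
  cases op with
  | xor =>
    intro ts hts σ hσ a ha
    obtain ⟨t, ht, hσ⟩ := mem_language_xor.1 hσ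
    exact ⟨t, ht, (hts t ht).mem_activities σ hσ a ha⟩
  | seq =>
    intro ts
    induction ts with
    | nil => simp +contextual [mem_language_seq_nil]
    | cons t ts ih =>
      intro hts σ hσ a ha
      obtain ⟨x, hx, y, hy, rfl⟩ := mem_language_seq_cons.1 hσ
      rcases List.mem_append.1 ha with ha | ha
      · exact ⟨t, by simp, (hts t (by simp)).mem_activities x hx a ha⟩
      · obtain ⟨s, hs, h⟩ := ih (fun s hs => hts s (by simp [hs])) hy a ha
        exact ⟨s, by simp [hs], h⟩
  | par =>
    intro ts
    induction ts with
    | nil => simp +contextual [mem_language_par_nil]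
    | cons t ts ih =>
      intro hts σ hσ a ha
      obtain ⟨x, hx, y, hy, hI⟩ := mem_language_par_cons.1 hσ
      rcases hI.mem.1 ha with ha | ha
      · exact ⟨t, by simp, (hts t (by simp)).mem_activities x hx a ha⟩
      · obtain ⟨s, hs, h⟩ := ih (fun s hs => hts s (by simp [hs])) hy a ha
        exact ⟨s, by simp [hs], h⟩
  | loop => exact absurd rfl hop

/-- A trace of the sequence is a concatenation of blocks with disjoint activities, and the
projection picks out the block of `t`. -/
theorem project_mem_language_of_seq {α : Type*} {ts : List (ProcessTree α)}
    (hts : ∀ t ∈ ts, t.IsProper) (hd : DisjointActivities ts) {σ : List α}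
    (hσ : σ ∈ (ProcessTree.node .seq ts).language) {t : ProcessTree α} (ht : t ∈ ts) :
    project t.activities σ ∈ t.language := by
  induction ts generalizing σ with
  | nil => simp at ht
  | cons s ts ih =>
    obtain ⟨x, hx, y, hy, rfl⟩ := mem_language_seq_cons.1 hσ
    have hts' : ∀ t ∈ ts, t.IsProper := fun t ht => hts t (by simp [ht])
    obtain ⟨hd₁, hd₂⟩ := List.pairwise_cons.1 hd
    rw [project_append]
    rcases List.mem_cons.1 ht with rfl | ht
    · rw [project_eq_self ((hts t (by simp)).mem_activities x hx), project_eq_nil (x := y)]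
      · simpa using hx
      · intro a ha hat
        obtain ⟨s, hs, has⟩ := exists_activities_of_mem_language (by simp) hts' hy a ha
        exact Set.disjoint_left.1 (hd₁ s hs) hat has
    · rw [project_eq_nil (x := x)]
      · simpa using ih hts' hd₂ hy ht
      · intro a ha hat
        exact Set.disjoint_left.1 (hd₁ t ht) ((hts s (by simp)).mem_activities x hx a ha) hat

theorem project_project_of_subset {α : Type*} {S T : Set α} (h : S ⊆ T) (x : List α) :
    project S (project T x) = project S x := by
  unfold project
  rw [List.filter_filter]
  refine List.filter_congr fun a _ => ?_
  by_cases ha : a ∈ S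
  · simp [ha, h ha]
  · simp [ha]

/-- With disjoint activities, interleaving imposes no condition beyond those on the projections.
Parallel nodes are handled through this criterion from here on. -/
theorem mem_language_par_iff {α : Type*} {ts : List (ProcessTree α)}
    (hts : ∀ t ∈ ts, t.IsProper) (hd : DisjointActivities ts) {σ : List α} :
    σ ∈ (ProcessTree.node .par ts).language ↔
      (∀ a ∈ σ, ∃ t ∈ ts, a ∈ t.activities) ∧
        ∀ t ∈ ts, project t.activities σ ∈ t.language := by
  refine ⟨fun hσ => ⟨exists_activities_of_mem_language (by simp) hts hσ, ?_⟩, ?_⟩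
  all_goals induction ts generalizing σ with
    | nil => simp [mem_language_par_nil, List.eq_nil_iff_forall_not_mem]
    | cons s ts ih => ?_
  all_goals
    have hts' : ∀ t ∈ ts, t.IsProper := fun t ht => hts t (by simp [ht])
    have hs := hts s (by simp)
    obtain ⟨hd₁, hd₂⟩ := List.pairwise_cons.1 hd
  · intro t ht
    obtain ⟨x, hx, y, hy, hI⟩ := mem_language_par_cons.1 hσ
    rcases List.mem_cons.1 ht with rfl | ht
    · rw [hI.project_append.1, project_eq_self (hs.mem_activities x hx)]
      · exact hx
      · intro a ha hat
        obtain ⟨s, hs, has⟩ := exists_activities_of_mem_language (by simp) hts' hy a ha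
        exact Set.disjoint_left.1 (hd₁ s hs) hat has
    · rw [hI.project_append.2]
      · exact ih hts' hd₂ hy t ht
      · intro a ha hat
        exact Set.disjoint_left.1 (hd₁ t ht) (hs.mem_activities x hx a ha) hat
  · rintro ⟨hact, hproj⟩
    have hsub : ∀ t ∈ ts, t.activities ⊆ {a | ∃ t ∈ ts, a ∈ t.activities} :=
      fun t ht a ha => ⟨t, ht, ha⟩
    -- The trace for the remaining children is the projection to the union of their activities.
    refine mem_language_par_cons.2 ⟨_, hproj s (by simp),
      project {a | ∃ t ∈ ts, a ∈ t.activities} σ, ih hts' hd₂ ⟨?_, ?_⟩,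
      interleaving_project ?_ ?_⟩
    · intro a ha
      exact (mem_project.1 ha).2
    · intro t ht
      rw [project_project_of_subset (hsub t ht)]
      exact hproj t (by simp [ht])
    · rw [Set.disjoint_left]
      rintro a ha ⟨t, ht, hat⟩
      exact Set.disjoint_left.1 (hd₁ t ht) ha hat
    · intro a ha
      obtain ⟨t, ht, hat⟩ := hact a ha
      rcases List.mem_cons.1 ht with rfl | ht
      · exact .inl hat
      · exact .inr ⟨t, ht, hat⟩

/-- A trace whose projections are traces of some of the trees can be completed, by a trace of the
other activities, to traces of the parallel composition. -/
theorem exists_completion {α : Type*} {ts : List (ProcessTree α)}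
    (hts : ∀ t ∈ ts, t.IsProper) (hd : DisjointActivities ts) {w : List α}
    (hw : ∀ t ∈ ts, project t.activities w ∈ t.language ∨ project t.activities w = []) :
    ∃ r : List α, (∀ a ∈ r, ∃ t ∈ ts, a ∈ t.activities) ∧ ∀ t ∈ ts,
      (project t.activities w ∈ t.language ∧ project t.activities r = []) ∨
        (project t.activities w = [] ∧ project t.activities r ∈ t.language) := by
  induction ts with
  | nil => exact ⟨[], by simp⟩
  | cons s ts ih =>
    have hts' : ∀ t ∈ ts, t.IsProper := fun t ht => hts t (by simp [ht])
    have hs := hts s (by simp)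
    obtain ⟨hd₁, hd₂⟩ := List.pairwise_cons.1 hd
    obtain ⟨r, hr, h⟩ := ih hts' hd₂ fun t ht => hw t (by simp [ht])
    have hrs : project s.activities r = [] := by
      refine project_eq_nil fun a ha has => ?_
      obtain ⟨t, ht, hat⟩ := hr a ha
      exact Set.disjoint_left.1 (hd₁ t ht) has hat
    rcases hw s (by simp) with hws | hws
    · refine ⟨r, fun a ha => ?_, fun t ht => ?_⟩
      · obtain ⟨t, ht, hat⟩ := hr a ha
        exact ⟨t, by simp [ht], hat⟩
      · rcases List.mem_cons.1 ht with rfl | ht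
        · exact .inl ⟨hws, hrs⟩
        · exact h t ht
    -- `w` has no event of `s`, so a whole trace of `s` is added to `r`; the other projections do
    -- not see it.
    · obtain ⟨x, hx⟩ := hs.exists_language
      have hxs := hs.mem_activities x hx
      refine ⟨x ++ r, fun a ha => ?_, fun t ht => ?_⟩
      · rcases List.mem_append.1 ha with ha | ha
        · exact ⟨s, by simp, hxs a ha⟩
        · obtain ⟨t, ht, hat⟩ := hr a ha
          exact ⟨t, by simp [ht], hat⟩
      · rcases List.mem_cons.1 ht with rfl | ht
        · refine .inr ⟨hws, ?_⟩
          rw [project_append, hrs, project_eq_self hxs]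
          simpa using hx
        · rw [project_append, project_eq_nil (x := x) fun a ha hat =>
            Set.disjoint_left.1 (hd₁ t ht) (hxs a ha) hat]
          simpa using h t ht

/-- Completions of a trace to traces of a parallel composition, at either end. -/
theorem exists_append_mem_par {α : Type*} {ts : List (ProcessTree α)}
    (hts : ∀ t ∈ ts, t.IsProper) (hd : DisjointActivities ts) {w : List α}
    (hact : ∀ a ∈ w, ∃ t ∈ ts, a ∈ t.activities)
    (hw : ∀ t ∈ ts, project t.activities w ∈ t.language ∨ project t.activities w = []) :
    ∃ r : List α, w ++ r ∈ (ProcessTree.node .par ts).language ∧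
      r ++ w ∈ (ProcessTree.node .par ts).language := by
  obtain ⟨r, hr, h⟩ := exists_completion hts hd hw
  -- Each child has its whole trace in `w` or in `r`, so either order of concatenation works.
  refine ⟨r, (mem_language_par_iff hts hd).2 ⟨?_, ?_⟩, (mem_language_par_iff hts hd).2 ⟨?_, ?_⟩⟩
  · intro a ha
    exact (List.mem_append.1 ha).elim (hact a) (hr a)
  · intro t ht
    rw [project_append]
    rcases h t ht with ⟨h₁, h₂⟩ | ⟨h₁, h₂⟩ <;> simp [h₁, h₂]
  · intro a ha
    exact (List.mem_append.1 ha).elim (hr a) (hact a)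
  · intro t ht
    rw [project_append]
    rcases h t ht with ⟨h₁, h₂⟩ | ⟨h₁, h₂⟩ <;> simp [h₁, h₂]

theorem exists_language_seq {α : Type*} : ∀ {ts : List (ProcessTree α)},
    (∀ t ∈ ts, t.IsProper) → ∃ σ, σ ∈ (ProcessTree.node .seq ts).language
  | [], _ => ⟨[], mem_language_seq_nil.2 rfl⟩
  | t :: ts, h => by
    obtain ⟨x, hx⟩ := (h t (by simp)).exists_language
    obtain ⟨y, hy⟩ := exists_language_seq fun t ht => h t (List.mem_cons_of_mem _ ht)
    exact ⟨x ++ y, mem_language_seq_cons.2 ⟨x, hx, y, hy, rfl⟩⟩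

/-- The projections of a trace of one tree to the trees of a list with disjoint activities. -/
theorem project_of_mem {α : Type*} {ts : List (ProcessTree α)} (hts : ∀ t ∈ ts, t.IsProper)
    (hd : DisjointActivities ts) {t : ProcessTree α} (ht : t ∈ ts) {w : List α}
    (hw : w ∈ t.language) : ∀ s ∈ ts,
      project s.activities w ∈ s.language ∨ project s.activities w = [] := by
  intro s hs
  have hwt := (hts t ht).mem_activities w hw
  by_cases hst : s = t
  · subst hst
    rw [project_eq_self hwt]
    exact .inl hw
  · exact .inr (project_eq_nil fun a ha has => hst (hd.eq_of_mem hs ht has (hwt a ha)))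

/-- The other children contribute arbitrary traces. That these avoid the activities of `t` is what
locates the neighbours of `w` in `start_child` and `finish_child`. -/
theorem exists_language_seq_extending {α : Type*} {ts : List (ProcessTree α)}
    (hts : ∀ t ∈ ts, t.IsProper) (hd : DisjointActivities ts) {t : ProcessTree α} (ht : t ∈ ts)
    {w : List α} (hw : w ∈ t.language) :
    ∃ u v : List α, u ++ w ++ v ∈ (ProcessTree.node .seq ts).language ∧
      (∀ a ∈ u, a ∉ t.activities) ∧ ∀ a ∈ v, a ∉ t.activities := by
  obtain ⟨p, q, rfl⟩ := List.append_of_mem ht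
  have hp : ∀ t ∈ p, t.IsProper := fun t ht => hts t (by simp [ht])
  have hq : ∀ t ∈ q, t.IsProper := fun t ht => hts t (by simp [ht])
  obtain ⟨-, hd₁, hd₂⟩ := List.pairwise_append.1 hd
  obtain ⟨u, hu⟩ := exists_language_seq hp
  obtain ⟨v, hv⟩ := exists_language_seq hq
  refine ⟨u, v, ?_, fun a ha hat => ?_, fun a ha hat => ?_⟩
  · exact mem_language_seq_append.2
      ⟨u, hu, w ++ v, mem_language_seq_cons.2 ⟨w, hw, v, hv, rfl⟩, by simp⟩
  · obtain ⟨s, hs, has⟩ := exists_activities_of_mem_language (by simp) hp hu a ha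
    exact Set.disjoint_left.1 (hd₂ s hs t (by simp)) has hat
  · obtain ⟨s, hs, has⟩ := exists_activities_of_mem_language (by simp) hq hv a ha
    exact Set.disjoint_left.1 ((List.pairwise_cons.1 hd₁).1 s hs) hat has

/-- Each trace of a child is a segment of a trace of the node. -/
theorem exists_language_node_extending {α : Type*} {op : Op} (hop : op ≠ .loop)
    {ts : List (ProcessTree α)} (hts : ∀ t ∈ ts, t.IsProper) (hd : DisjointActivities ts)
    {t : ProcessTree α} (ht : t ∈ ts) {w : List α} (hw : w ∈ t.language) :
    ∃ u v : List α, u ++ w ++ v ∈ (ProcessTree.node op ts).language := by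
  cases op with
  | xor => exact ⟨[], [], mem_language_xor.2 ⟨t, ht, by simpa using hw⟩⟩
  | seq =>
    obtain ⟨u, v, h, -⟩ := exists_language_seq_extending hts hd ht hw
    exact ⟨u, v, h⟩
  | par =>
    obtain ⟨r, h, -⟩ := exists_append_mem_par hts hd
      (fun a ha => ⟨t, ht, (hts t ht).mem_activities w hw a ha⟩) (project_of_mem hts hd ht hw)
    exact ⟨[], r, h⟩
  | loop => exact absurd rfl hop

/-- The projection of a trace of the node to a child: for choice, if the trace has an activity of
the child. -/
theorem project_mem_language {α : Type*} {op : Op} (hop : op ≠ .loop)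
    {ts : List (ProcessTree α)} (hts : ∀ t ∈ ts, t.IsProper) (hd : DisjointActivities ts)
    {t : ProcessTree α} (ht : t ∈ ts) {σ : List α}
    (hσ : σ ∈ (ProcessTree.node op ts).language) {a : α} (ha : a ∈ σ) (hat : a ∈ t.activities) :
    project t.activities σ ∈ t.language := by
  cases op with
  | xor =>
    obtain ⟨s, hs, hσ⟩ := mem_language_xor.1 hσ
    have h := (hts s hs).mem_activities σ hσ
    obtain rfl := hd.eq_of_mem hs ht (h a ha) hat
    rwa [project_eq_self h]
  | seq => exact project_mem_language_of_seq hts hd hσ ht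
  | par => exact ((mem_language_par_iff hts hd).1 hσ).2 t ht
  | loop => exact absurd rfl hop

theorem isProper_node {α : Type*} {op : Op} (hop : op ≠ .loop)
    {ts : List (ProcessTree α)} (hts : ∀ t ∈ ts, t.IsProper) (hd : DisjointActivities ts)
    (hne : ts ≠ []) : (ProcessTree.node op ts).IsProper where
  nil_notMem := by
    intro h
    obtain ⟨t, l, rfl⟩ := List.exists_cons_of_ne_nil hne
    cases op with
    | xor =>
      obtain ⟨s, hs, h⟩ := mem_language_xor.1 h
      exact (hts s hs).nil_notMem h
    | seq =>
      exact (hts t (by simp)).nil_notMem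
        (by simpa [project] using project_mem_language_of_seq hts hd h (t := t) (by simp))
    | par =>
      exact (hts t (by simp)).nil_notMem
        (by simpa [project] using ((mem_language_par_iff hts hd).1 h).2 t (by simp))
    | loop => exact absurd rfl hop
  mem_activities σ hσ a ha :=
    mem_activities_node.2 (exists_activities_of_mem_language hop hts hσ a ha)
  exists_mem a ha := by
    obtain ⟨t, ht, hat⟩ := mem_activities_node.1 ha
    obtain ⟨w, hw, haw⟩ := (hts t ht).exists_mem a hat
    obtain ⟨u, v, h⟩ := exists_language_node_extending hop hts hd ht hw
    exact ⟨_, h, by simp [haw]⟩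
  nonempty := by
    obtain ⟨t, l, rfl⟩ := List.exists_cons_of_ne_nil hne
    obtain ⟨a, ha⟩ := (hts t (by simp)).nonempty
    exact ⟨a, mem_activities_node.2 ⟨t, by simp, ha⟩⟩

theorem isProper_act {α : Type*} (a : α) : (ProcessTree.act a).IsProper where
  nil_notMem h := by
    simp only [ProcessTree.language] at h
    exact absurd (Set.mem_singleton_iff.1 h) (by simp)
  mem_activities σ hσ b hb := by
    simp only [ProcessTree.language] at hσ
    rw [Set.mem_singleton_iff.1 hσ] at hb
    rwa [activities_act, Set.mem_singleton_iff, ← List.mem_singleton]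
  exists_mem b hb := by
    rw [activities_act, Set.mem_singleton_iff] at hb
    exact ⟨[a], by simp only [ProcessTree.language]; rfl, by simp [hb]⟩
  nonempty := ⟨a, by simp [activities_act]⟩

theorem activities_selfLoop {α : Type*} (v : α) :
    (ProcessTree.node .loop [.act v, .tau]).activities = {v} := by
  ext b
  simp [mem_activities_node, activities_act, activities_tau]

theorem isProper_selfLoop {α : Type*} (v : α) :
    (ProcessTree.node .loop [.act v, .tau]).IsProper where
  nil_notMem h := (mem_language_selfLoop.1 h).1 rfl
  mem_activities σ hσ b hb := by
    simpa [activities_selfLoop] using (mem_language_selfLoop.1 hσ).2 b hb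
  exists_mem b hb := by
    rw [activities_selfLoop, Set.mem_singleton_iff] at hb
    exact ⟨[v], mem_language_selfLoop.2 (by simp), by simp [hb]⟩
  nonempty := ⟨v, by simp [activities_selfLoop]⟩

/-! ## Directly-follows graphs of process trees -/

theorem ProcessTree.IsProper.dfg_activities {α : Type*} {t : ProcessTree α} (h : t.IsProper) :
    t.dfg.activities = t.activities := by
  ext a
  constructor
  · rintro ⟨σ, hσ, ha⟩
    exact h.mem_activities σ hσ a ha
  · exact h.exists_mem a

theorem ProcessTree.IsProper.mem_of_edge {α : Type*} {t : ProcessTree α} (h : t.IsProper)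
    {a b : α} (hab : t.dfg.edge a b) : a ∈ t.activities ∧ b ∈ t.activities := by
  rw [← h.dfg_activities]
  exact dfgOf_mem_of_edge hab

/-- Between activities of a child, the graph of the node has the edges of the graph of the
child. -/
theorem edge_node_iff {α : Type*} {op : Op} (hop : op ≠ .loop)
    {ts : List (ProcessTree α)} (hts : ∀ t ∈ ts, t.IsProper) (hd : DisjointActivities ts)
    {t : ProcessTree α} (ht : t ∈ ts) {a b : α} (ha : a ∈ t.activities) (hb : b ∈ t.activities) :
    (ProcessTree.node op ts).dfg.edge a b ↔ t.dfg.edge a b := by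
  constructor
  · rintro ⟨σ, hσ, hab⟩
    exact ⟨_, project_mem_language hop hts hd ht hσ (hab.subset (by simp)) ha,
      infix_project ha hb hab⟩
  · rintro ⟨w, hw, hab⟩
    obtain ⟨u, v, h⟩ := exists_language_node_extending hop hts hd ht hw
    exact ⟨_, h, hab.trans ⟨u, v, rfl⟩⟩

theorem mem_of_edge_xor {α : Type*} {ts : List (ProcessTree α)} (hts : ∀ t ∈ ts, t.IsProper)
    (hd : DisjointActivities ts) {t : ProcessTree α} (ht : t ∈ ts) {a b : α}
    (hab : (ProcessTree.node .xor ts).dfg.edge a b) :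
    a ∈ t.activities ↔ b ∈ t.activities := by
  obtain ⟨σ, hσ, hab⟩ := hab
  obtain ⟨s, hs, hσ⟩ := mem_language_xor.1 hσ
  have h := (hts s hs).mem_activities σ hσ
  have ha := h a (hab.subset (by simp))
  have hb := h b (hab.subset (by simp))
  constructor
  · intro hat
    rwa [hd.eq_of_mem ht hs hat ha]
  · intro hbt
    rwa [hd.eq_of_mem ht hs hbt hb]

/-- In the graph of a sequence, the later children cannot be left. -/
theorem mem_of_transGen_seq {α : Type*} {p q : List (ProcessTree α)}
    (hts : ∀ t ∈ p ++ q, t.IsProper) (hd : DisjointActivities (p ++ q)) {a b : α}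
    (ha : ∃ t ∈ q, a ∈ t.activities)
    (hab : Relation.TransGen (ProcessTree.node .seq (p ++ q)).dfg.edge a b) :
    ∃ t ∈ q, b ∈ t.activities := by
  have hp : ∀ t ∈ p, t.IsProper := fun t ht => hts t (by simp [ht])
  have hq : ∀ t ∈ q, t.IsProper := fun t ht => hts t (by simp [ht])
  obtain ⟨-, -, hd'⟩ := List.pairwise_append.1 hd
  have step : ∀ a b, (∃ t ∈ q, a ∈ t.activities) →
      (ProcessTree.node .seq (p ++ q)).dfg.edge a b → ∃ t ∈ q, b ∈ t.activities := by
    rintro a b ⟨t, ht, hat⟩ ⟨σ, hσ, l, r, h⟩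
    obtain ⟨x, hx, y, hy, rfl⟩ := mem_language_seq_append.1 hσ
    refine exists_activities_of_mem_language (by simp) hq hy b ?_
    -- Compares the end of `x` with the position of `[a, b]`: if `x` reaches past `l`, then `a` is
    -- an activity of `p`, against disjointness; otherwise `b` lies in `y`.
    rw [List.append_assoc, List.append_eq_append_iff] at h
    rcases h with ⟨u, rfl, h⟩ | ⟨u, rfl, rfl⟩
    · rcases u with _ | ⟨c, u⟩
      · rw [List.nil_append] at h
        simp [← h]
      · obtain ⟨rfl, -⟩ : a = c ∧ _ := by simpa using h
        obtain ⟨s, hs, has⟩ :=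
          exists_activities_of_mem_language (by simp) hp hx a (by simp)
        exact absurd hat (Set.disjoint_left.1 (hd' s hs t ht) has)
    · simp
  induction hab with
  | single h => exact step _ _ ha h
  | tail _ h ih => exact step _ _ ih h

/-- Cut the sequence between the two children: a trace of the front through `a`, followed by one of
the back through `b`, gives the path, and the back cannot be left. -/
theorem seq_pairwise {α : Type*} {ts : List (ProcessTree α)} (hts : ∀ t ∈ ts, t.IsProper)
    (hd : DisjointActivities ts) :
    ts.Pairwise fun s t => ∀ a ∈ s.activities, ∀ b ∈ t.activities,
      Relation.TransGen (ProcessTree.node .seq ts).dfg.edge a b ∧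
        ¬ Relation.TransGen (ProcessTree.node .seq ts).dfg.edge b a := by
  refine pairwise_of_append fun p q hpq s hs t ht a ha b hb => ?_
  subst hpq
  have hp : ∀ t ∈ p, t.IsProper := fun t ht => hts t (by simp [ht])
  have hq : ∀ t ∈ q, t.IsProper := fun t ht => hts t (by simp [ht])
  obtain ⟨hdp, hdq, hd'⟩ := List.pairwise_append.1 hd
  constructor
  · obtain ⟨x, hx, hax⟩ := (hp s hs).exists_mem a ha
    obtain ⟨y, hy, hby⟩ := (hq t ht).exists_mem b hb
    obtain ⟨u, v, hx'⟩ := exists_language_node_extending (op := .seq) (by simp) hp hdp hs hx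
    obtain ⟨u', v', hy'⟩ := exists_language_node_extending (op := .seq) (by simp) hq hdq ht hy
    exact transGen_of_mem_append (mem_language_seq_append.2 ⟨_, hx', _, hy', rfl⟩)
      (by simp [hax]) (by simp [hby])
  · intro h
    obtain ⟨t', ht', hat'⟩ := mem_of_transGen_seq hts hd ⟨t, ht, hb⟩ h
    exact Set.disjoint_left.1 (hd' s hs t' ht') ha hat'

/-- In the graph of a sequence, paths between activities of a child do not leave the child. -/
theorem mem_of_transGen_of_transGen_seq {α : Type*} {ts : List (ProcessTree α)}
    (hts : ∀ t ∈ ts, t.IsProper) (hd : DisjointActivities ts) {t : ProcessTree α} (ht : t ∈ ts)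
    {a b c : α} (ha : a ∈ t.activities) (hb : b ∈ t.activities)
    (hac : Relation.TransGen (ProcessTree.node .seq ts).dfg.edge a c)
    (hcb : Relation.TransGen (ProcessTree.node .seq ts).dfg.edge c b) : c ∈ t.activities := by
  have hproper : (ProcessTree.node .seq ts).IsProper :=
    isProper_node (by simp) hts hd (List.ne_nil_of_mem ht)
  have hc : c ∈ (ProcessTree.node .seq ts).activities := by
    cases hac with
    | single h => exact (hproper.mem_of_edge h).2
    | tail _ h => exact (hproper.mem_of_edge h).2
  obtain ⟨s, hs, hcs⟩ := mem_activities_node.1 hc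
  by_contra hct
  have hst : s ≠ t := by
    rintro rfl
    exact hct hcs
  -- Paths in both directions between different children are impossible, whatever their endpoints.
  -- Unlike `seq_pairwise`, this form is symmetric, so the order of `s` and `t` is irrelevant.
  have hsymm : Std.Symm (fun s t : ProcessTree α => ∀ a ∈ s.activities, ∀ b ∈ t.activities,
      ∀ a' ∈ s.activities, ∀ b' ∈ t.activities,
      ¬ (Relation.TransGen (ProcessTree.node .seq ts).dfg.edge a b ∧
        Relation.TransGen (ProcessTree.node .seq ts).dfg.edge b' a')) :=
    ⟨fun s t h a ha b hb a' ha' b' hb' h' => h b' hb' a' ha' b hb a ha ⟨h'.2, h'.1⟩⟩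
  have hpair := (seq_pairwise hts hd).imp (S := fun s t : ProcessTree α =>
    ∀ a ∈ s.activities, ∀ b ∈ t.activities, ∀ a' ∈ s.activities, ∀ b' ∈ t.activities,
      ¬ (Relation.TransGen (ProcessTree.node .seq ts).dfg.edge a b ∧
        Relation.TransGen (ProcessTree.node .seq ts).dfg.edge b' a'))
    fun h a _ b _ a' ha' b' hb' h' => (h a' ha' b' hb').2 h'.2
  exact hpair.forall hs ht hst c hcs b hb c hcs a ha ⟨hcb, hac⟩

/-- Traces `x₁ a x₂` and `y₁ b y₂` of the two children interleave to `x₁ y₁ a b x₂ y₂`, and the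
other children can run afterwards. -/
theorem par_edge {α : Type*} {ts : List (ProcessTree α)} (hts : ∀ t ∈ ts, t.IsProper)
    (hd : DisjointActivities ts) {s t : ProcessTree α} (hs : s ∈ ts) (ht : t ∈ ts)
    (hst : s ≠ t) {a b : α} (ha : a ∈ s.activities) (hb : b ∈ t.activities) :
    (ProcessTree.node .par ts).dfg.edge a b := by
  obtain ⟨x, hx, hax⟩ := (hts s hs).exists_mem a ha
  obtain ⟨y, hy, hby⟩ := (hts t ht).exists_mem b hb
  have hxs := (hts s hs).mem_activities x hx
  have hyt := (hts t ht).mem_activities y hy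
  obtain ⟨x₁, x₂, rfl⟩ := List.append_of_mem hax
  obtain ⟨y₁, y₂, rfl⟩ := List.append_of_mem hby
  -- the two traces, interleaved such that `b` follows `a`
  have hproj : ∀ A : Set α, project A (x₁ ++ y₁ ++ [a, b] ++ x₂ ++ y₂) =
      project A x₁ ++ project A y₁ ++ project A [a] ++ project A [b] ++ project A x₂ ++
        project A y₂ := by
    intro A
    rw [show x₁ ++ y₁ ++ [a, b] ++ x₂ ++ y₂ = x₁ ++ y₁ ++ [a] ++ [b] ++ x₂ ++ y₂ by simp]
    simp only [project_append]
  obtain ⟨r, h, -⟩ := exists_append_mem_par hts hd (w := x₁ ++ y₁ ++ [a, b] ++ x₂ ++ y₂)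
    (fun c hc => by
      have : c ∈ x₁ ++ a :: x₂ ∨ c ∈ y₁ ++ b :: y₂ := by
        simp only [List.mem_append, List.mem_cons, List.not_mem_nil, or_false] at hc ⊢
        tauto
      rcases this with h | h
      · exact ⟨s, hs, hxs c h⟩
      · exact ⟨t, ht, hyt c h⟩)
    (fun u hu => by
      rw [hproj]
      have hx' : u ≠ s → ∀ c ∈ x₁ ++ a :: x₂, c ∉ u.activities :=
        fun hus c hc hcu => hus (hd.eq_of_mem hu hs hcu (hxs c hc))
      have hy' : u ≠ t → ∀ c ∈ y₁ ++ b :: y₂, c ∉ u.activities :=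
        fun hut c hc hcu => hut (hd.eq_of_mem hu ht hcu (hyt c hc))
      have hxe : x₁ ++ a :: x₂ = x₁ ++ [a] ++ x₂ := by simp
      have hye : y₁ ++ b :: y₂ = y₁ ++ [b] ++ y₂ := by simp
      have nil_of : ∀ {l : List α}, (∀ c ∈ l, c ∉ u.activities) →
          project u.activities l = [] := fun h => project_eq_nil h
      -- For `u = s` only the first trace survives the projection; for all other `u`, including `t`,
      -- only events of the second can.
      by_cases hus : u = s
      · subst hus
        have h := hy' hst
        rw [nil_of (l := y₁) fun c hc => h c (by simp [hc]), nil_of (l := [b]) fun c hc =>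
          h c (by rw [List.mem_singleton] at hc; simp [hc]), nil_of (l := y₂) fun c hc => h c (by simp [hc])]
        simp only [List.append_nil, ← project_append]
        rw [← hxe, project_eq_self hxs]
        exact .inl hx
      · have h := hx' hus
        rw [nil_of (l := x₁) fun c hc => h c (by simp [hc]), nil_of (l := [a]) fun c hc =>
          h c (by rw [List.mem_singleton] at hc; simp [hc]), nil_of (l := x₂) fun c hc => h c (by simp [hc])]
        simp only [List.append_nil, List.nil_append, ← project_append]
        rw [← hye]
        exact project_of_mem hts hd ht hy u hu)
  exact ⟨_, h, x₁ ++ y₁, x₂ ++ y₂ ++ r, by simp⟩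

theorem start_par {α : Type*} {ts : List (ProcessTree α)} (hts : ∀ t ∈ ts, t.IsProper)
    (hd : DisjointActivities ts) {t : ProcessTree α} (ht : t ∈ ts) :
    t.dfg.start ⊆ (ProcessTree.node .par ts).dfg.start := by
  rintro a ⟨w, hw, ha⟩
  obtain ⟨r, h, -⟩ := exists_append_mem_par hts hd
    (fun a ha => ⟨t, ht, (hts t ht).mem_activities w hw a ha⟩) (project_of_mem hts hd ht hw)
  exact ⟨_, h, by simp [List.head?_append, ha]⟩

theorem finish_par {α : Type*} {ts : List (ProcessTree α)} (hts : ∀ t ∈ ts, t.IsProper)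
    (hd : DisjointActivities ts) {t : ProcessTree α} (ht : t ∈ ts) :
    t.dfg.finish ⊆ (ProcessTree.node .par ts).dfg.finish := by
  rintro a ⟨w, hw, ha⟩
  obtain ⟨r, -, h⟩ := exists_append_mem_par hts hd
    (fun a ha => ⟨t, ht, (hts t ht).mem_activities w hw a ha⟩) (project_of_mem hts hd ht hw)
  exact ⟨_, h, by simp [List.getLast?_append, ha]⟩

theorem ProcessTree.IsProper.exists_start_finish {α : Type*} {t : ProcessTree α}
    (h : t.IsProper) :
    (t.activities ∩ t.dfg.start).Nonempty ∧ (t.activities ∩ t.dfg.finish).Nonempty := by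
  obtain ⟨w, hw⟩ := h.exists_language
  have hne : w ≠ [] := by
    rintro rfl
    exact h.nil_notMem hw
  exact ⟨⟨w.head hne, h.mem_activities w hw _ (List.head_mem hne), w, hw,
      List.head?_eq_some_head hne⟩,
    ⟨w.getLast hne, h.mem_activities w hw _ (List.getLast_mem hne), w, hw,
      List.getLast?_eq_some_getLast hne⟩⟩

/-- The children of a choice, sequence or parallel node are a cut. -/
theorem isCut_node {α : Type*} {op : Op} (hop : op ≠ .loop)
    {ts : List (ProcessTree α)} (hts : ∀ t ∈ ts, t.IsProper) (hd : DisjointActivities ts)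
    (h2 : 2 ≤ ts.length) :
    IsCut (ProcessTree.node op ts).dfg op (ts.map ProcessTree.activities) := by
  have hne : ts ≠ [] := by
    rintro rfl
    simp at h2
  -- Disjoint nonempty activity sets force the trees at different positions to be different.
  have hne_tree : ts.Pairwise fun s t => s ∈ ts ∧ t ∈ ts ∧ s ≠ t := by
    refine (List.Pairwise.and_mem.1 hd).imp ?_
    rintro s t ⟨hs, ht, h⟩
    refine ⟨hs, ht, ?_⟩
    rintro rfl
    exact (hts s hs).nonempty.ne_empty (disjoint_self.1 h)
  refine ⟨by simpa using h2, ?_, List.pairwise_map.2 hd, ?_, ?_⟩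
  · intro S hS
    obtain ⟨t, ht, rfl⟩ := List.mem_map.1 hS
    exact (hts t ht).nonempty
  · rw [(isProper_node hop hts hd hne).dfg_activities]
    ext a
    simp [mem_activities_node]
  · cases op with
    | xor =>
      refine List.pairwise_map.2 (hne_tree.imp ?_)
      rintro s t ⟨hs, ht, hst⟩ a ha b hb
      exact ⟨fun h => hst (hd.eq_of_mem hs ht ((mem_of_edge_xor hts hd hs h).1 ha) hb),
        fun h => hst (hd.eq_of_mem hs ht ha ((mem_of_edge_xor hts hd ht h).1 hb))⟩
    | seq => exact List.pairwise_map.2 (seq_pairwise hts hd)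
    | par =>
      refine ⟨List.pairwise_map.2 (hne_tree.imp ?_), ?_⟩
      · rintro s t ⟨hs, ht, hst⟩ a ha b hb
        exact ⟨par_edge hts hd hs ht hst ha hb, par_edge hts hd ht hs hst.symm hb ha⟩
      · intro S hS
        obtain ⟨t, ht, rfl⟩ := List.mem_map.1 hS
        obtain ⟨h₁, h₂⟩ := (hts t ht).exists_start_finish
        exact ⟨h₁.mono (Set.inter_subset_inter_right _ (start_par hts hd ht)),
          h₂.mono (Set.inter_subset_inter_right _ (finish_par hts hd ht))⟩
    | loop => exact absurd rfl hop

/-- Activities of a child that are separated in the graph of the node, with respect to the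
operator of the node, are separated in the graph of the child. -/
theorem separates_of_node {α : Type*} {op : Op} (hop : op ≠ .loop)
    {ts : List (ProcessTree α)} (hts : ∀ t ∈ ts, t.IsProper) (hd : DisjointActivities ts)
    {t : ProcessTree α} (ht : t ∈ ts) {a b : α} (ha : a ∈ t.activities) (hb : b ∈ t.activities)
    (h : Separates (ProcessTree.node op ts).dfg op a b) : Separates t.dfg op a b := by
  have hedge : ∀ c ∈ t.activities, ∀ d ∈ t.activities,
      (ProcessTree.node op ts).dfg.edge c d ↔ t.dfg.edge c d :=
    fun c hc d hd' => edge_node_iff hop hts hd ht hc hd'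
  have hup : ∀ {c d}, Relation.TransGen t.dfg.edge c d →
      Relation.TransGen (ProcessTree.node op ts).dfg.edge c d :=
    fun h => Relation.TransGen.mono (fun c d hcd =>
      have := (hts t ht).mem_of_edge hcd
      (hedge c this.1 d this.2).2 hcd) _ _ h
  cases op with
  | xor => exact ⟨fun h' => h.1 (hup h'), fun h' => h.2 (hup h')⟩
  | seq =>
    -- Choice only needs non-reachability to descend, which is `hup`. For sequences reachability
    -- descends too, because paths between activities of the child stay inside it.
    have hdown : ∀ {c d}, c ∈ t.activities → d ∈ t.activities →
        Relation.TransGen (ProcessTree.node .seq ts).dfg.edge c d →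
        Relation.TransGen t.dfg.edge c d := fun hc hd' h =>
      transGen_restrict (fun c hc d hd' => (hedge c hc d hd').1) hc hd'
        (fun _ ha _ h₁ h₂ => mem_of_transGen_of_transGen_seq hts hd ht ha hd' h₁ h₂) h
    rcases h with ⟨h₁, h₂⟩ | ⟨h₁, h₂⟩
    · exact .inl ⟨hdown ha hb h₁, fun h' => h₂ (hup h')⟩
    · exact .inr ⟨hdown hb ha h₁, fun h' => h₂ (hup h')⟩
  | par => exact ⟨(hedge a ha b hb).1 h.1, (hedge b hb a ha).1 h.2⟩
  | loop => exact absurd rfl hop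

/-! ## Trees in normal form of class `C_a` -/

/-- The trees of class `C_a` in normal form, other than `τ`. -/
inductive IsReduced {α : Type*} : ProcessTree α → Prop
  | act (a : α) : IsReduced (.act a)
  | selfLoop (v : α) : IsReduced (.node .loop [.act v, .tau])
  | node {op : Op} {ts : List (ProcessTree α)} (hop : op ≠ .loop) (h2 : 2 ≤ ts.length)
      (hd : DisjointActivities ts) (hnf : ∀ us : List (ProcessTree α), .node op us ∉ ts)
      (hts : ∀ t ∈ ts, IsReduced t) : IsReduced (.node op ts)

/-- Both hypotheses speak of all subtrees and so pass to the children, where the class excludes `τ`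
below non-loop nodes. -/
theorem eq_tau_or_isReduced {α : Type*} (M : ProcessTree α) (hM : M.InClassCa)
    (hnf : M.IsNormalForm) : M = .tau ∨ IsReduced M := by
  match M with
  | .tau => exact .inl rfl
  | .act a => exact .inr (.act a)
  | .node op ts =>
    right
    obtain ⟨hd, hloop, htau⟩ := hM op ts .refl
    obtain ⟨h2, h⟩ := hnf op ts .refl
    by_cases hop : op = .loop
    · obtain ⟨v, rfl⟩ := hloop hop
      subst hop
      exact .selfLoop v
    · refine .node hop h2 hd (h hop) fun t ht => ?_
      refine (eq_tau_or_isReduced t (fun op us hsub => hM op us (.child ht hsub))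
        fun op us hsub => hnf op us (.child ht hsub)).resolve_left ?_
      rintro rfl
      exact htau hop ht
termination_by sizeOf M
decreasing_by
  have := List.sizeOf_lt_of_mem ht
  simp
  omega

theorem IsReduced.isProper {α : Type*} {M : ProcessTree α} (h : IsReduced M) : M.IsProper := by
  induction h with
  | act a => exact isProper_act a
  | selfLoop v => exact isProper_selfLoop v
  | node hop h2 hd _ _ ih =>
    refine isProper_node hop ih hd ?_
    rintro rfl
    simp at h2

/-- Each child of a reduced node lies in one part of each cut for the operator of the node. -/
theorem exists_part_of_child {α : Type*} {op : Op} (hop : op ≠ .loop)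
    {ts : List (ProcessTree α)} (hts : ∀ t ∈ ts, IsReduced t) (hd : DisjointActivities ts)
    (hnf : ∀ us : List (ProcessTree α), .node op us ∉ ts) {Ss : List (Set α)}
    (hcut : IsCut (ProcessTree.node op ts).dfg op Ss) {t : ProcessTree α} (ht : t ∈ ts) :
    ∃ S ∈ Ss, t.activities ⊆ S := by
  have hts' : ∀ t ∈ ts, t.IsProper := fun t ht => (hts t ht).isProper
  have hact := (isProper_node hop hts' hd (List.ne_nil_of_mem ht)).dfg_activities
  have hmem : ∀ a ∈ t.activities, a ∈ (ProcessTree.node op ts).dfg.activities :=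
    fun a ha => hact ▸ mem_activities_node.2 ⟨t, ht, ha⟩
  have hsingle : ∀ a, t.activities = {a} → ∃ S ∈ Ss, t.activities ⊆ S := by
    intro a ha
    obtain ⟨S, hS, haS⟩ := hcut.exists_mem (hmem a (by simp [ha]))
    exact ⟨S, hS, by simpa [ha] using haS⟩
  cases hts t ht with
  | act a => exact hsingle a (activities_act a)
  | selfLoop v => exact hsingle v (activities_selfLoop v)
  | @node op' us hop' h2 hd' hnf' hus =>
    have hus' : ∀ u ∈ us, u.IsProper := fun u hu => (hus u hu).isProper
    have hcut' := isCut_node hop' hus' hd' h2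
    have hne : op' ≠ op := by
      rintro rfl
      exact hnf us ht
    obtain ⟨a, ha⟩ := (hts' _ ht).nonempty
    obtain ⟨S, hS, haS⟩ := hcut.exists_mem (hmem a ha)
    refine ⟨S, hS, fun b hb => ?_⟩
    obtain ⟨s, hs, has⟩ := mem_activities_node.1 ha
    obtain ⟨u, hu, hbu⟩ := mem_activities_node.1 hb
    -- Different parts of the child are separated for `op'`, hence not for `op`, neither in the
    -- graph of the child nor in that of the node; so they share a part of `Ss`.
    refine rel_of_rel_across (r := fun a b => ∀ S ∈ Ss, a ∈ S → b ∈ S) hcut'.1 hcut'.2.1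
      hcut'.2.2.1 (fun a b c h₁ h₂ S hS ha => h₂ S hS (h₁ S hS ha)) ?_
      (List.mem_map_of_mem hs) (List.mem_map_of_mem hu) has hbu S hS haS
    intro B hB C hC hBC b hb c hc
    have hb' := hcut'.mem_activities hB hb
    have hc' := hcut'.mem_activities hC hc
    rw [(hts' _ ht).dfg_activities] at hb' hc'
    refine hcut.mem_of_not_separates dfgOf_edge_mem hop (hmem c hc') fun hsep => hne ?_
    exact (hcut'.separates dfgOf_edge_mem hop' hB hC hBC hb hc).op_unique
      (separates_of_node hop hts' hd ht hb' hc' hsep)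

theorem length_le_and_perm_of_isCut {α : Type*} {op : Op} (hop : op ≠ .loop)
    {ts : List (ProcessTree α)} (h2 : 2 ≤ ts.length) (hts : ∀ t ∈ ts, IsReduced t)
    (hd : DisjointActivities ts) (hnf : ∀ us : List (ProcessTree α), .node op us ∉ ts)
    {Ss : List (Set α)} (hcut : IsCut (ProcessTree.node op ts).dfg op Ss) :
    Ss.length ≤ ts.length ∧
      (ts.length ≤ Ss.length → Ss.Perm (ts.map ProcessTree.activities)) := by
  have hcut' := isCut_node hop (fun t ht => (hts t ht).isProper) hd h2
  have h := length_le_and_perm_of_refines hcut.2.2.1 hcut.2.1 hcut'.2.2.1 hcut'.2.1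
    (hcut.2.2.2.1.trans hcut'.2.2.2.1.symm) (by
      intro B hB
      obtain ⟨t, ht, rfl⟩ := List.mem_map.1 hB
      exact exists_part_of_child hop hts hd hnf hcut ht)
  simpa using h

theorem selectsCut_node {α : Type*} {op : Op} (hop : op ≠ .loop)
    {ts : List (ProcessTree α)} (h2 : 2 ≤ ts.length) (hts : ∀ t ∈ ts, IsReduced t)
    (hd : DisjointActivities ts) (hnf : ∀ us : List (ProcessTree α), .node op us ∉ ts) :
    SelectsCut (ProcessTree.node op ts).dfg op (ts.map ProcessTree.activities) := by
  have hcut := isCut_node hop (fun t ht => (hts t ht).isProper) hd h2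
  refine ⟨hcut, fun op' Ss hrank hcut' => ?_, fun Ss hcut' => ?_⟩
  -- Loop cuts are tried last, so uniqueness among the other operators suffices.
  · have hop' : op' ≠ .loop := by
      rintro rfl
      cases op <;> simp [Op.rank] at hrank
    rw [hcut'.op_unique dfgOf_edge_mem hop' hop hcut] at hrank
    exact lt_irrefl _ hrank
  · simpa using (length_le_and_perm_of_isCut hop h2 hts hd hnf hcut').1

/-- The selected cut of the graph of a node consists of the children, up to an allowed
reordering. -/
theorem SelectsCut.eq_node {α : Type*} {op : Op} (hop : op ≠ .loop)
    {ts : List (ProcessTree α)} (h2 : 2 ≤ ts.length) (hts : ∀ t ∈ ts, IsReduced t)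
    (hd : DisjointActivities ts) (hnf : ∀ us : List (ProcessTree α), .node op us ∉ ts)
    {op' : Op} {Ss : List (Set α)} (h : SelectsCut (ProcessTree.node op ts).dfg op' Ss) :
    op' = op ∧ Reorder op Ss (ts.map ProcessTree.activities) := by
  have h' := selectsCut_node hop h2 hts hd hnf
  have hrank : op'.rank = op.rank :=
    le_antisymm (not_lt.1 fun hlt => h.2.1 _ _ hlt h'.1) (not_lt.1 fun hlt => h'.2.1 _ _ hlt h.1)
  obtain rfl : op' = op := by
    cases op <;> cases op' <;> first | rfl | simp [Op.rank] at hrank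
  refine ⟨rfl, ?_⟩
  have hperm := (length_le_and_perm_of_isCut hop h2 hts hd hnf h.1).2
    (by simpa using h.2.2 _ h'.1)
  cases op' with
  | xor => exact .xor hperm
  | seq =>
    rw [h.1.eq_of_perm h'.1 hperm]
    exact .seq _
  | par => exact .par hperm
  | loop => exact absurd rfl hop

/-! ## Splitting fitting and directly-follows complete logs -/

theorem activities_of_dfComplete {α : Type*} {L : EventLog α} {M : ProcessTree α}
    (h : DfComplete L M) {a : α} (ha : a ∈ M.dfg.activities) : ∃ σ ∈ L, a ∈ σ := by
  rw [← h] at ha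
  exact ha

theorem start_of_dfComplete {α : Type*} {L : EventLog α} {M : ProcessTree α}
    (h : DfComplete L M) {a : α} (ha : a ∈ M.dfg.start) : ∃ σ ∈ L, σ.head? = some a := by
  rw [← h] at ha
  exact ha

theorem finish_of_dfComplete {α : Type*} {L : EventLog α} {M : ProcessTree α}
    (h : DfComplete L M) {a : α} (ha : a ∈ M.dfg.finish) : ∃ σ ∈ L, σ.getLast? = some a := by
  rw [← h] at ha
  exact ha

theorem edge_of_dfComplete {α : Type*} {L : EventLog α} {M : ProcessTree α}
    (h : DfComplete L M) {a b : α} (hab : M.dfg.edge a b) : ∃ σ ∈ L, [a, b] <:+: σ := by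
  rw [← h] at hab
  exact hab

/-- Fitness gives one inclusion of the graphs, so only witnesses in the log for the graph of the
model are required. -/
theorem dfComplete_of_fitting {α : Type*} {L : EventLog α} {M : ProcessTree α}
    (hfit : ∀ σ ∈ L, σ ∈ M.language)
    (hact : ∀ a ∈ M.dfg.activities, ∃ σ ∈ L, a ∈ σ)
    (hstart : ∀ a ∈ M.dfg.start, ∃ σ ∈ L, σ.head? = some a)
    (hfinish : ∀ a ∈ M.dfg.finish, ∃ σ ∈ L, σ.getLast? = some a)
    (hedge : ∀ a b, M.dfg.edge a b → ∃ σ ∈ L, [a, b] <:+: σ) : DfComplete L M := by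
  refine DFG.ext (Set.Subset.antisymm ?_ hact) (Set.Subset.antisymm ?_ hstart)
    (Set.Subset.antisymm ?_ hfinish) ?_
  · rintro a ⟨σ, hσ, h⟩
    exact ⟨σ, hfit σ hσ, h⟩
  · rintro a ⟨σ, hσ, h⟩
    exact ⟨σ, hfit σ hσ, h⟩
  · rintro a ⟨σ, hσ, h⟩
    exact ⟨σ, hfit σ hσ, h⟩
  · funext a b
    refine propext ⟨?_, hedge a b⟩
    rintro ⟨σ, hσ, h⟩
    exact ⟨σ, hfit σ hσ, h⟩

theorem head?_project {α : Type*} {S : Set α} {σ : List α} {a : α} (ha : a ∈ S)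
    (h : σ.head? = some a) : (project S σ).head? = some a := by
  obtain ⟨l, rfl⟩ := List.head?_eq_some_iff.1 h
  rw [project_cons_of_mem ha]
  rfl

theorem getLast?_project {α : Type*} {S : Set α} {σ : List α} {a : α} (ha : a ∈ S)
    (h : σ.getLast? = some a) : (project S σ).getLast? = some a := by
  obtain ⟨l, rfl⟩ := List.getLast?_eq_some_iff.1 h
  rw [project_append, project_eq_self (x := [a]) (by simpa using ha)]
  simp

open Classical in
theorem mem_splitLog_xor {α : Type*} {L : EventLog α} {S : Set α} {τ : List α} :
    τ ∈ splitLog L S .xor ↔ τ ∈ L ∧ ∀ a ∈ τ, a ∈ S :=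
  Multiset.mem_filter

theorem mem_language_of_mem_splitLog {α : Type*} {op : Op} (hop : op ≠ .loop)
    {ts : List (ProcessTree α)} (hts : ∀ t ∈ ts, t.IsProper) (hd : DisjointActivities ts)
    {L : EventLog α} (hfit : ∀ σ ∈ L, σ ∈ (ProcessTree.node op ts).language)
    {t : ProcessTree α} (ht : t ∈ ts) : ∀ τ ∈ splitLog L t.activities op, τ ∈ t.language := by
  intro τ hτ
  cases op with
  | xor =>
    obtain ⟨hτL, hτt⟩ := mem_splitLog_xor.1 hτ
    obtain ⟨s, hs, hτs⟩ := mem_language_xor.1 (hfit τ hτL)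
    cases τ with
    -- The empty trace would pass the filter for every child, but no child accepts it.
    | nil => exact absurd hτs (hts s hs).nil_notMem
    | cons a l =>
      rwa [hd.eq_of_mem ht hs (hτt a (by simp)) ((hts s hs).mem_activities _ hτs a (by simp))]
  | seq =>
    obtain ⟨σ, hσ, rfl⟩ := Multiset.mem_map.1 hτ
    exact project_mem_language_of_seq hts hd (hfit σ hσ) ht
  | par =>
    obtain ⟨σ, hσ, rfl⟩ := Multiset.mem_map.1 hτ
    exact ((mem_language_par_iff hts hd).1 (hfit σ hσ)).2 t ht
  | loop => exact absurd rfl hop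

/-- Lets the three operators be treated alike: for choice, a trace with an activity of `t` lies in
`t` and equals its projection. -/
theorem project_mem_splitLog {α : Type*} {op : Op} (hop : op ≠ .loop)
    {ts : List (ProcessTree α)} (hts : ∀ t ∈ ts, t.IsProper) (hd : DisjointActivities ts)
    {L : EventLog α} (hfit : ∀ σ ∈ L, σ ∈ (ProcessTree.node op ts).language)
    {t : ProcessTree α} (ht : t ∈ ts) {σ : List α} (hσ : σ ∈ L) {a : α} (ha : a ∈ σ)
    (hat : a ∈ t.activities) : project t.activities σ ∈ splitLog L t.activities op := by
  cases op with
  | xor =>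
    obtain ⟨s, hs, hσs⟩ := mem_language_xor.1 (hfit σ hσ)
    have h := (hts s hs).mem_activities σ hσs
    obtain rfl := hd.eq_of_mem ht hs hat (h a ha)
    rw [project_eq_self h]
    exact mem_splitLog_xor.2 ⟨hσ, h⟩
  | seq => exact Multiset.mem_map_of_mem _ hσ
  | par => exact Multiset.mem_map_of_mem _ hσ
  | loop => exact absurd rfl hop

/-- The start activities of a child are start activities of the node, or, in a sequence, follow
an activity outside of the child. -/
theorem start_child {α : Type*} {op : Op} (hop : op ≠ .loop)
    {ts : List (ProcessTree α)} (hts : ∀ t ∈ ts, t.IsProper) (hd : DisjointActivities ts)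
    {t : ProcessTree α} (ht : t ∈ ts) {a : α} (ha : a ∈ t.dfg.start) :
    a ∈ (ProcessTree.node op ts).dfg.start ∨
      op = .seq ∧ ∃ e ∉ t.activities, (ProcessTree.node op ts).dfg.edge e a := by
  cases op with
  | xor =>
    obtain ⟨w, hw, ha⟩ := ha
    exact .inl ⟨w, mem_language_xor.2 ⟨t, ht, hw⟩, ha⟩
  | seq =>
    obtain ⟨w, hw, ha⟩ := ha
    obtain ⟨u, v, h, hu, -⟩ := exists_language_seq_extending hts hd ht hw
    obtain ⟨w, rfl⟩ := List.head?_eq_some_iff.1 ha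
    rcases List.eq_nil_or_concat u with rfl | ⟨u, e, rfl⟩
    · exact .inl ⟨_, h, by simp⟩
    · exact .inr ⟨rfl, e, hu e (by simp), _, h, u, w ++ v, by simp⟩
  | par => exact .inl (start_par hts hd ht ha)
  | loop => exact absurd rfl hop

/-- The end activities of a child are end activities of the node, or, in a sequence, precede an
activity outside of the child. -/
theorem finish_child {α : Type*} {op : Op} (hop : op ≠ .loop)
    {ts : List (ProcessTree α)} (hts : ∀ t ∈ ts, t.IsProper) (hd : DisjointActivities ts)
    {t : ProcessTree α} (ht : t ∈ ts) {a : α} (ha : a ∈ t.dfg.finish) :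
    a ∈ (ProcessTree.node op ts).dfg.finish ∨
      op = .seq ∧ ∃ e ∉ t.activities, (ProcessTree.node op ts).dfg.edge a e := by
  cases op with
  | xor =>
    obtain ⟨w, hw, ha⟩ := ha
    exact .inl ⟨w, mem_language_xor.2 ⟨t, ht, hw⟩, ha⟩
  | seq =>
    obtain ⟨w, hw, ha⟩ := ha
    obtain ⟨u, v, h, -, hv⟩ := exists_language_seq_extending hts hd ht hw
    obtain ⟨w, rfl⟩ := List.getLast?_eq_some_iff.1 ha
    cases v with
    | nil => exact .inl ⟨_, h, by simp [← List.append_assoc]⟩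
    | cons e v => exact .inr ⟨rfl, e, hv e (by simp), _, h, u ++ w, v, by simp⟩
  | par => exact .inl (finish_par hts hd ht ha)
  | loop => exact absurd rfl hop

/-- Activities and edges survive projection. A start activity of a child in a sequence may never
start a trace of the log, but then an edge of the log enters it from outside the child, and the
projection of that trace starts there. End activities are dual. -/
theorem dfComplete_splitLog {α : Type*} {op : Op} (hop : op ≠ .loop)
    {ts : List (ProcessTree α)} (hts : ∀ t ∈ ts, t.IsProper) (hd : DisjointActivities ts)
    {L : EventLog α} (hfit : ∀ σ ∈ L, σ ∈ (ProcessTree.node op ts).language)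
    (hdf : DfComplete L (.node op ts)) {t : ProcessTree α} (ht : t ∈ ts) :
    DfComplete (splitLog L t.activities op) t := by
  have hactM := (isProper_node hop hts hd (List.ne_nil_of_mem ht)).dfg_activities
  have hactt := (hts t ht).dfg_activities
  have hstart : ∀ a ∈ t.dfg.start, a ∈ t.activities := by
    rintro a ⟨w, hw, ha⟩
    exact (hts t ht).mem_activities w hw a (List.mem_of_mem_head? ha)
  have hfinish : ∀ a ∈ t.dfg.finish, a ∈ t.activities := by
    rintro a ⟨w, hw, ha⟩
    exact (hts t ht).mem_activities w hw a (List.mem_of_getLast? ha)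
  refine dfComplete_of_fitting (mem_language_of_mem_splitLog hop hts hd hfit ht) ?_ ?_ ?_ ?_
  · intro a ha
    rw [hactt] at ha
    obtain ⟨σ, hσ, haσ⟩ := activities_of_dfComplete hdf
      (hactM ▸ mem_activities_node.2 ⟨t, ht, ha⟩)
    exact ⟨_, project_mem_splitLog hop hts hd hfit ht hσ haσ ha, mem_project.2 ⟨haσ, ha⟩⟩
  · intro a ha
    have hat := hstart a ha
    rcases start_child hop hts hd ht ha with h | ⟨rfl, e, he, h⟩
    · obtain ⟨σ, hσ, haσ⟩ := start_of_dfComplete hdf h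
      exact ⟨_, project_mem_splitLog hop hts hd hfit ht hσ (List.mem_of_mem_head? haσ) hat,
        head?_project hat haσ⟩
    · obtain ⟨σ, hσ, p, q, rfl⟩ := edge_of_dfComplete hdf h
      refine ⟨_, project_mem_splitLog hop hts hd hfit ht hσ (a := a) (by simp) hat, ?_⟩
      -- An earlier event `c` of the child would give a path from `c` through `e` to `a` that leaves
      -- the child.
      have hp : ∀ c ∈ p ++ [e], c ∉ t.activities := by
        intro c hc hct
        rcases List.mem_append.1 hc with hc | hc
        · refine he (mem_of_transGen_of_transGen_seq hts hd ht hct hat ?_ (.single h))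
          exact transGen_of_mem_append (x := p) (y := [e, a] ++ q)
            (by simpa using hfit _ hσ) hc (by simp)
        · rw [List.mem_singleton.1 hc] at hct
          exact he hct
      rw [show p ++ [e, a] ++ q = (p ++ [e]) ++ a :: q by simp, project_append,
        project_eq_nil hp, project_cons_of_mem hat]
      rfl
  · intro a ha
    have hat := hfinish a ha
    rcases finish_child hop hts hd ht ha with h | ⟨rfl, e, he, h⟩
    · obtain ⟨σ, hσ, haσ⟩ := finish_of_dfComplete hdf h
      exact ⟨_, project_mem_splitLog hop hts hd hfit ht hσ (List.mem_of_getLast? haσ) hat,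
        getLast?_project hat haσ⟩
    · obtain ⟨σ, hσ, p, q, rfl⟩ := edge_of_dfComplete hdf h
      refine ⟨_, project_mem_splitLog hop hts hd hfit ht hσ (a := a) (by simp) hat, ?_⟩
      have hq : ∀ c ∈ e :: q, c ∉ t.activities := by
        intro c hc hct
        rcases List.mem_cons.1 hc with rfl | hc
        · exact he hct
        · refine he (mem_of_transGen_of_transGen_seq hts hd ht hat hct (.single h) ?_)
          exact transGen_of_mem_append (x := p ++ [a, e]) (y := q)
            (by simpa using hfit _ hσ) (by simp) hc
      rw [show p ++ [a, e] ++ q = (p ++ [a]) ++ e :: q by simp, project_append,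
        project_eq_nil hq, project_append, project_eq_self (x := [a]) (by simpa using hat)]
      simp
  · intro a b hab
    obtain ⟨hat, hbt⟩ := (hts t ht).mem_of_edge hab
    obtain ⟨σ, hσ, h⟩ := edge_of_dfComplete hdf ((edge_node_iff hop hts hd ht hat hbt).2 hab)
    exact ⟨_, project_mem_splitLog hop hts hd hfit ht hσ (h.subset (by simp)) hat,
      infix_project hat hbt h⟩

/-! ## Runs of the Inductive Miner -/

theorem InductiveMiner.eq_tau {α : Type*} {L : EventLog α} (hL : ∀ σ ∈ L, σ = [])
    {M : ProcessTree α} (h : InductiveMiner L M) : M = .tau := by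
  have hcuts : ¬ ReachesCuts L := by
    rintro ⟨h0, hnil, -⟩
    obtain ⟨σ, hσ⟩ := Multiset.exists_mem_of_ne_zero h0
    exact hnil (hL σ hσ ▸ hσ)
  cases h with
  | noEvents h => rfl
  | singleActivity h =>
    obtain ⟨σ, hσ⟩ := Multiset.exists_mem_of_ne_zero h.1
    exact absurd ((hL σ hσ).symm.trans (h.2 σ hσ)) (by simp)
  | emptyTraces h h' _ =>
    obtain ⟨σ, hσ, hne⟩ := h'
    exact absurd (hL σ hσ) hne
  | cut h _ _ => exact absurd h hcuts
  | activityOncePerTrace h _ _ => exact absurd h.1 hcuts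
  | activityConcurrent h _ _ _ _ => exact absurd h.1 hcuts
  | strictTauLoop h _ _ _ _ => exact absurd h.1 hcuts
  | tauLoop h _ _ _ _ _ => exact absurd h.1 hcuts
  | flowerModel h _ _ _ _ _ _ => exact absurd h.1 hcuts

theorem InductiveMiner.eq_act {α : Type*} {L : EventLog α} {a : α} (hL : IsSingleActivity L a)
    {M : ProcessTree α} (h : InductiveMiner L M) : M = .act a := by
  have hcuts : ¬ ReachesCuts L := fun h => h.2.2 a hL
  obtain ⟨σ, hσ⟩ := Multiset.exists_mem_of_ne_zero hL.1
  cases h with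
  | noEvents h => exact absurd ((h σ hσ).symm.trans (hL.2 σ hσ)) (by simp)
  | singleActivity h =>
    have := (h.2 σ hσ).symm.trans (hL.2 σ hσ)
    simp_all
  | emptyTraces h _ _ => exact absurd (hL.2 _ h) (by simp)
  | cut h _ _ => exact absurd h hcuts
  | activityOncePerTrace h _ _ => exact absurd h.1 hcuts
  | activityConcurrent h _ _ _ _ => exact absurd h.1 hcuts
  | strictTauLoop h _ _ _ _ => exact absurd h.1 hcuts
  | tauLoop h _ _ _ _ _ => exact absurd h.1 hcuts
  | flowerModel h _ _ _ _ _ _ => exact absurd h.1 hcuts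

theorem ReachesCuts.not_noEvents {α : Type*} {L : EventLog α} (h : ReachesCuts L) :
    ¬ ∀ σ ∈ L, σ = [] := by
  intro h'
  obtain ⟨σ, hσ⟩ := Multiset.exists_mem_of_ne_zero h.1
  exact h.2.1 (h' σ hσ ▸ hσ)

/-- If there is a cut, then a run selects a cut. -/
theorem InductiveMiner.exists_cut {α : Type*} {L : EventLog α} (hL : ReachesCuts L)
    (hcut : HasCut (EventLog.dfg L)) {M : ProcessTree α} (h : InductiveMiner L M) :
    ∃ op Ss Ms, M = .node op Ms ∧ SelectsCut (EventLog.dfg L) op Ss ∧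
      List.Forall₂ InductiveMiner (Ss.map fun S => splitLog L S op) Ms := by
  cases h with
  | noEvents h => exact absurd h hL.not_noEvents
  | singleActivity h => exact absurd h (hL.2.2 _)
  | emptyTraces h _ _ => exact absurd h hL.2.1
  | cut _ hsel hMs => exact ⟨_, _, _, rfl, hsel, hMs⟩
  | activityOncePerTrace h _ _ => exact absurd hcut h.2
  | activityConcurrent h _ _ _ _ => exact absurd hcut h.2
  | strictTauLoop h _ _ _ _ => exact absurd hcut h.2
  | tauLoop h _ _ _ _ _ => exact absurd hcut h.2
  | flowerModel h _ _ _ _ _ _ => exact absurd hcut h.2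

/-- Carries a reordering of the parts of a cut over to the subtrees discovered from them. -/
theorem forall₂_of_reorder {β γ : Type*} {R : β → γ → Prop} {op : Op} (hop : op ≠ .loop)
    {l l' : List β} {m : List γ} (h : Reorder op l l') (hR : List.Forall₂ R l m) :
    ∃ m', Reorder op m m' ∧ List.Forall₂ R l' m' := by
  have key : l.Perm l' → ∃ m', m.Perm m' ∧ List.Forall₂ R l' m' := by
    intro hperm
    obtain ⟨m', h₁, h₂⟩ := List.perm_comp_forall₂ hperm.symm hR
    exact ⟨m', h₂.symm, h₁⟩
  cases h with
  | xor h =>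
    obtain ⟨m', h₁, h₂⟩ := key h
    exact ⟨m', .xor h₁, h₂⟩
  | par h =>
    obtain ⟨m', h₁, h₂⟩ := key h
    exact ⟨m', .par h₁, h₂⟩
  | seq => exact ⟨m, .seq m, hR⟩
  | loop => exact absurd rfl hop

theorem exists_forall₂ {β γ : Type*} {R : β → γ → Prop} : ∀ {l : List β},
    (∀ x ∈ l, ∃ y, R x y) → ∃ m, List.Forall₂ R l m
  | [], _ => ⟨[], .nil⟩
  | x :: l, h => by
    obtain ⟨y, hy⟩ := h x (by simp)
    obtain ⟨m, hm⟩ := exists_forall₂ fun x hx => h x (List.mem_cons_of_mem _ hx)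
    exact ⟨y :: m, .cons hy hm⟩

theorem forall₂_of_mem {β γ : Type*} {R : β → γ → Prop} {S : γ → β → Prop} {l : List β}
    {m : List γ} (h : List.Forall₂ R l m) (hS : ∀ x ∈ l, ∀ y, R x y → S y x) :
    List.Forall₂ S m l := by
  induction h with
  | nil => exact .nil
  | cons h _ ih =>
    exact .cons (hS _ (by simp) _ h) (ih fun x hx => hS x (List.mem_cons_of_mem _ hx))

/-! ## Self-loops -/

/-- The traces of the log are nonempty repetitions of `v`, and one of them has at least two
events. -/
structure IsSelfLoopLog {α : Type*} (L : EventLog α) (v : α) : Prop where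
  fitting : ∀ σ ∈ L, σ ≠ [] ∧ ∀ a ∈ σ, a = v
  edge : ∃ σ ∈ L, [v, v] <:+: σ

theorem IsSelfLoopLog.eq_of_mem {α : Type*} {L : EventLog α} {v : α} (h : IsSelfLoopLog L v)
    {a : α} (ha : a ∈ (EventLog.dfg L).activities) : a = v := by
  obtain ⟨σ, hσ, ha⟩ := ha
  exact (h.fitting σ hσ).2 a ha

theorem not_hasCut_of_subsingleton {α : Type*} {G : DFG α} (h : G.activities.Subsingleton) :
    ¬ HasCut G := by
  rintro ⟨op, Ss, hcut⟩
  obtain ⟨h2, hne, hd, -, -⟩ := id hcut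
  match Ss, h2, hne, hd, hcut with
  | S :: T :: _, _, hne, hd, hcut =>
    obtain ⟨a, ha⟩ := hne S (by simp)
    obtain ⟨b, hb⟩ := hne T (by simp)
    have hab := h (hcut.mem_activities (by simp) ha) (hcut.mem_activities (by simp) hb)
    exact Set.disjoint_left.1 ((List.pairwise_cons.1 hd).1 T (by simp)) ha (hab ▸ hb)

theorem IsSelfLoopLog.reachesFallThroughs {α : Type*} {L : EventLog α} {v : α}
    (h : IsSelfLoopLog L v) : ReachesFallThroughs L := by
  obtain ⟨σ, hσ, hvv⟩ := h.edge
  refine ⟨⟨?_, fun h' => (h.fitting _ h').1 rfl, fun a ha => ?_⟩, ?_⟩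
  · rintro rfl
    simp at hσ
  · rw [ha.2 σ hσ] at hvv
    simpa using hvv.length_le
  · exact not_hasCut_of_subsingleton fun a ha b hb => (h.eq_of_mem ha).trans (h.eq_of_mem hb).symm

theorem IsSelfLoopLog.not_oncePerTrace {α : Type*} {L : EventLog α} {v : α}
    (h : IsSelfLoopLog L v) (a : α) : ¬ OncePerTrace L a := by
  intro ha
  obtain ⟨σ, hσ, hvv⟩ := h.edge
  have hσa := ha σ hσ
  have hav : a = v := (h.fitting σ hσ).2 a (mem_project.1 (hσa ▸ List.mem_singleton_self a)).1
  subst hav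
  have := infix_project (S := {a}) rfl rfl hvv
  rw [hσa] at this
  simpa using this.length_le

/-- Only `v` can be left out, and then no activity remains to be partitioned. -/
theorem IsSelfLoopLog.not_concurrentActivity {α : Type*} {L : EventLog α} {v : α}
    (h : IsSelfLoopLog L v) (a : α) : ¬ ConcurrentActivity L a := by
  rintro ⟨ha, hcut⟩
  refine not_hasCut_of_subsingleton (fun b hb => ?_) hcut
  obtain ⟨τ, hτ, hb⟩ := hb
  obtain ⟨σ, hσ, rfl⟩ := Multiset.mem_map.1 hτ
  obtain ⟨hbσ, hba⟩ := mem_project.1 hb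
  exact absurd (((h.fitting σ hσ).2 b hbσ).trans (h.eq_of_mem ha).symm) hba

/-- Blocks are nonempty chains for `r`, and a longer block would contain the forbidden pair `v, v`.
-/
theorem eq_singleton_of_mem_splitBy {α : Type*} {v : α}
    {r : α → α → Bool} (hr : r v v = false) {σ : List α} (hσ : ∀ a ∈ σ, a = v) :
    ∀ τ ∈ σ.splitBy r, τ = [v] := by
  intro τ hτ
  have hmem : ∀ a ∈ τ, a = v := by
    intro a ha
    refine hσ a ?_
    rw [← List.flatten_splitBy r σ]
    exact List.mem_flatten.2 ⟨τ, hτ, ha⟩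
  have hchain := List.isChain_of_mem_splitBy hτ
  match τ, hτ, hmem, hchain with
  | [], hτ, _, _ => exact absurd hτ (List.nil_notMem_splitBy r σ)
  | [a], _, hmem, _ => rw [hmem a (by simp)]
  | a :: b :: l, _, hmem, hchain =>
    have := (List.isChain_cons_cons.1 hchain).1
    rw [hmem a (by simp), hmem b (by simp), hr] at this
    exact absurd this (by simp)

/-- `v` is both a start and an end activity, so a trace with `n` events splits into `n` traces
`⟨v⟩`; the trace with `v, v` makes the count grow strictly. -/
theorem IsSelfLoopLog.hasStrictTauLoop {α : Type*} {L : EventLog α} {v : α}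
    (h : IsSelfLoopLog L v) :
    HasStrictTauLoop L ∧ IsSingleActivity (strictTauSplit L) v := by
  classical
  obtain ⟨σ₀, hσ₀, hvv⟩ := h.edge
  have hstart : v ∈ (EventLog.dfg L).start := by
    refine ⟨σ₀, hσ₀, ?_⟩
    rw [List.head?_eq_some_head (h.fitting σ₀ hσ₀).1, (h.fitting σ₀ hσ₀).2 _ (List.head_mem _)]
  have hfinish : v ∈ (EventLog.dfg L).finish := by
    refine ⟨σ₀, hσ₀, ?_⟩
    rw [List.getLast?_eq_some_getLast (h.fitting σ₀ hσ₀).1,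
      (h.fitting σ₀ hσ₀).2 _ (List.getLast_mem _)]
  have hr : decide (¬ (v ∈ (EventLog.dfg L).finish ∧ v ∈ (EventLog.dfg L).start)) = false := by
    simp [hstart, hfinish]
  have hsplit : ∀ σ ∈ L, ∀ τ ∈ σ.splitBy (fun a b =>
      decide (¬ (a ∈ (EventLog.dfg L).finish ∧ b ∈ (EventLog.dfg L).start))), τ = [v] :=
    fun σ hσ => eq_singleton_of_mem_splitBy hr (h.fitting σ hσ).2
  have hlen : ∀ σ ∈ L, (σ.splitBy (fun a b =>
      decide (¬ (a ∈ (EventLog.dfg L).finish ∧ b ∈ (EventLog.dfg L).start)))).length =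
        σ.length := by
    intro σ hσ
    conv_rhs => rw [← List.flatten_splitBy (fun a b =>
      decide (¬ (a ∈ (EventLog.dfg L).finish ∧ b ∈ (EventLog.dfg L).start))) σ]
    rw [List.eq_replicate_of_mem (hsplit σ hσ)]
    simp
  have hlt : HasStrictTauLoop L := by
    unfold HasStrictTauLoop strictTauSplit
    rw [Multiset.card_bind]
    have hL : L.card = (L.map fun _ => 1).sum := by simp
    rw [hL]
    refine Multiset.sum_lt_sum (fun σ hσ => ?_) ⟨σ₀, hσ₀, ?_⟩
    · rw [Function.comp_apply, Multiset.coe_card, hlen σ hσ]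
      exact List.length_pos_of_ne_nil (h.fitting σ hσ).1
    · rw [Function.comp_apply, Multiset.coe_card, hlen σ₀ hσ₀]
      exact hvv.length_le
  refine ⟨hlt, ?_, ?_⟩
  · intro h0
    unfold HasStrictTauLoop at hlt
    rw [h0] at hlt
    simp at hlt
  · intro τ hτ
    obtain ⟨σ, hσ, hτ⟩ := Multiset.mem_bind.1 hτ
    exact hsplit σ hσ τ hτ

theorem IsSelfLoopLog.inductiveMiner {α : Type*} {L : EventLog α} {v : α}
    (h : IsSelfLoopLog L v) : InductiveMiner L (.node .loop [.act v, .tau]) :=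
  .strictTauLoop h.reachesFallThroughs h.not_oncePerTrace h.not_concurrentActivity
    h.hasStrictTauLoop.1 (.singleActivity h.hasStrictTauLoop.2)

theorem IsSelfLoopLog.eq_selfLoop {α : Type*} {L : EventLog α} {v : α} (h : IsSelfLoopLog L v)
    {M : ProcessTree α} (hM : InductiveMiner L M) : M = .node .loop [.act v, .tau] := by
  have hft := h.reachesFallThroughs
  cases hM with
  | noEvents h' => exact absurd h' hft.1.not_noEvents
  | singleActivity h' => exact absurd h' (hft.1.2.2 _)
  | emptyTraces h' _ _ => exact absurd h' hft.1.2.1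
  | cut _ hsel _ => exact absurd ⟨_, _, hsel.1⟩ hft.2
  | activityOncePerTrace _ ha _ => exact absurd ha (h.not_oncePerTrace _)
  | activityConcurrent _ _ ha _ _ => exact absurd ha (h.not_concurrentActivity _)
  | strictTauLoop _ _ _ _ hM => rw [hM.eq_act h.hasStrictTauLoop.2]
  | tauLoop _ _ _ hl _ _ => exact absurd h.hasStrictTauLoop.1 hl
  | flowerModel _ _ _ hl _ _ _ => exact absurd h.hasStrictTauLoop.1 hl

/-! ## Rediscovery -/

/-- If all traces were `⟨a⟩`, completeness would leave the graph of `M` a single activity and hence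
no cut. -/
theorem ProcessTree.IsProper.reachesCuts {α : Type*} {M : ProcessTree α} (hM : M.IsProper)
    {L : EventLog α} (hfit : ∀ σ ∈ L, σ ∈ M.language) (hdf : DfComplete L M)
    (hcut : HasCut M.dfg) : ReachesCuts L := by
  refine ⟨?_, fun h => hM.nil_notMem (hfit _ h), fun a ha => ?_⟩
  · rintro rfl
    obtain ⟨a, ha⟩ := hM.nonempty
    rw [← hM.dfg_activities] at ha
    obtain ⟨σ, hσ, -⟩ := activities_of_dfComplete hdf ha
    simp at hσ
  · refine not_hasCut_of_subsingleton (fun b hb c hc => ?_) hcut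
    have hall : ∀ b ∈ M.dfg.activities, b = a := by
      intro b hb
      obtain ⟨σ, hσ, hbσ⟩ := activities_of_dfComplete hdf hb
      rw [ha.2 σ hσ] at hbσ
      simpa using hbσ
    rw [hall b hb, hall c hc]

theorem IsReduced.rediscovers {α : Type*} {M : ProcessTree α} (hM : IsReduced M) :
    ∀ L : EventLog α, (∀ σ ∈ L, σ ∈ M.language) → DfComplete L M →
      (∃ M', InductiveMiner L M') ∧ ∀ M', InductiveMiner L M' → Isomorphic M' M := by
  induction hM with
  | act a =>
    intro L hfit hdf
    have hL : IsSingleActivity L a := by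
      refine ⟨?_, fun σ hσ => ?_⟩
      · rintro rfl
        obtain ⟨σ, hσ, -⟩ := activities_of_dfComplete hdf
          ((isProper_act a).dfg_activities ▸ (activities_act a).symm ▸ rfl : a ∈ _)
        simp at hσ
      · have := hfit σ hσ
        simp only [ProcessTree.language] at this
        exact Set.mem_singleton_iff.1 this
    refine ⟨⟨_, .singleActivity hL⟩, fun M' h => ?_⟩
    rw [h.eq_act hL]
    exact .act a
  | selfLoop v =>
    intro L hfit hdf
    have hL : IsSelfLoopLog L v := by
      refine ⟨fun σ hσ => mem_language_selfLoop.1 (hfit σ hσ), edge_of_dfComplete hdf ?_⟩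
      exact ⟨[v, v], mem_language_selfLoop.2 (by simp), List.infix_rfl⟩
    refine ⟨⟨_, hL.inductiveMiner⟩, fun M' h => ?_⟩
    rw [hL.eq_selfLoop h]
    exact .node (.loop _ (.refl _)) (.cons (.act v) (.cons .tau .nil))
  | @node op ts hop h2 hd hnf hts ih =>
    intro L hfit hdf
    have hproper : ∀ t ∈ ts, t.IsProper := fun t ht => (hts t ht).isProper
    have hne : ts ≠ [] := by
      rintro rfl
      simp at h2
    have hsel := selectsCut_node hop h2 hts hd hnf
    have hL := (isProper_node hop hproper hd hne).reachesCuts hfit hdf ⟨_, _, hsel.1⟩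
    have hchild : ∀ t ∈ ts, (∃ M', InductiveMiner (splitLog L t.activities op) M') ∧
        ∀ M', InductiveMiner (splitLog L t.activities op) M' → Isomorphic M' t :=
      fun t ht => ih t ht _ (mem_language_of_mem_splitLog hop hproper hd hfit ht)
        (dfComplete_splitLog hop hproper hd hfit hdf ht)
    -- Cut selection sees only the graph, so the cuts selected for `L` are those of the tree.
    have hdfg : EventLog.dfg L = (ProcessTree.node op ts).dfg := hdf
    constructor
    · obtain ⟨Ms, hMs⟩ := exists_forall₂ fun t ht => (hchild t ht).1
      refine ⟨.node op Ms, .cut hL (hdfg ▸ hsel) ?_⟩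
      rw [List.map_map]
      exact List.forall₂_map_left_iff.2 hMs
    · intro M' hM'
      obtain ⟨op', Ss, Ms, rfl, hsel', hMs⟩ := hM'.exists_cut hL (hdfg ▸ ⟨_, _, hsel.1⟩)
      obtain ⟨rfl, hreorder⟩ := SelectsCut.eq_node hop h2 hts hd hnf (hdfg ▸ hsel')
      obtain ⟨us, hus, h⟩ := forall₂_of_reorder hop hreorder (List.forall₂_map_left_iff.1 hMs)
      exact .node hus (forall₂_of_mem (List.forall₂_map_left_iff.1 h) fun t ht =>
        (hchild t ht).2)

end ProcessDiscovery

open ProcessDiscovery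

theorem lemma3 {α : Type*} (M : ProcessTree α) (L : EventLog α)
    (hM : M.InClassCa) (hnf : M.IsNormalForm)
    (hfit : ∀ σ ∈ L, σ ∈ M.language) (hdf : DfComplete L M) :
    (∃ M' : ProcessTree α, InductiveMiner L M') ∧
      ∀ M' : ProcessTree α, InductiveMiner L M' → Isomorphic M' M := by
  rcases eq_tau_or_isReduced M hM hnf with rfl | hred
  · have hL : ∀ σ ∈ L, σ = [] := by
      intro σ hσ
      have := hfit σ hσ
      simpa only [ProcessTree.language, Language.mem_one] using this
    refine ⟨⟨_, .noEvents hL⟩, fun M' h => ?_⟩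
    rw [h.eq_tau hL]
    exact .tau
  · exact hred.rediscovers L hfit hdf
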